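/- **Setting.** Let $\mathbb H$ be the upper half-plane with its hyperbolic metric, $T(z)=z+1$, and let $C=\mathbb H/\langle T\rangle$ be the parabolic cylinder, whose puncture corresponds to $\operatorname{Im} z\to\infty$. For $p\ge 1$, a *$p$-sided polygonal cusp* is a closed subset $D\subset C$ that contains $\{\operatorname{Im} z\ge M\}/\langle T\rangle$ for some $M$, is contained in $\{\operatorname{Im} z\ge\varepsilon\}/\langle T\rangle$ for some $\varepsilon>0$, and whose boundary is a simple closed curve going once around $C$ and made of $p$ nondegenerate geodesic segments, its *sides*, joined end to end (interior angles may take any value in $(0,2\pi)$). Its *perimeter* is the sum of the lengths of its sides, and its *area* is its hyperbolic area. It is *regular* if all its sides have the same length and the interior angles at all its vertices are equal. **Lemma 2.9.** Let $p\ge 1$ and let $P$ be a $p$-sided polygonal cusp. Then there is a regular $p$-sided polygonal cusp with the same area as $P$. Every regular $p$-sided polygonal cusp $R$ with $\operatorname{area}(R)=\operatorname{area}(P)$ satisfies $$\operatorname{perimeter}(R)\le\operatorname{perimeter}(P),$$ and if equality holds then $P$ is regular. In other words, among all $p$-sided polygonal cusps of a given area, the least perimeter is attained by the regular one, and only by it.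 -/

import Mathlib

open MeasureTheory

/-- The geodesic segment joining two points of the hyperbolic plane: the points lying between
them for the hyperbolic distance. -/
def geodesicSegment (z w : UpperHalfPlane) : Set UpperHalfPlane :=
  {x | dist z x + dist x w = dist z w}

/-- For `w ≠ z`, a nonzero complex number pointing in the direction of the initial velocity at `z`
of the geodesic from `z` to `w`. Indeed `x ↦ (x - z) / (x - conj z)` is an isometry onto the
Poincaré disc sending `z` to `0`, geodesics from `z` to radii, and its derivative at `z` is a
positive multiple of `-I`. -/
noncomputable def geodesicDirection (z w : UpperHalfPlane) : ℂ :=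
  Complex.I * (((w : ℂ) - (z : ℂ)) / ((w : ℂ) - (starRingEnd ℂ) (z : ℂ)))

/-- A `p`-sided polygonal cusp, as a region in the parabolic cylinder `ℍ / ⟨T⟩`, `T z = z + 1`,
given by its `T`-invariant preimage in `ℍ`. The region is a closed neighbourhood of the puncture
whose boundary is a simple closed piecewise geodesic curve with `p` sides. The boundary is
described by its lift: a bi-infinite `T`-periodic sequence of vertices, indexed so that the curve
goes once around the cylinder in the direction of increasing real part, that is, with the region
on its left. -/
structure PolygonalCusp (p : ℕ) where
  /-- The preimage of the region in the hyperbolic plane. -/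
  region : Set UpperHalfPlane
  /-- The lifted vertices, in order along the boundary. -/
  vertex : ℤ → UpperHalfPlane
  isClosed_region : IsClosed region
  /-- The region is invariant under `T`. -/
  translate_mem_iff : ∀ z : UpperHalfPlane, (1 : ℝ) +ᵥ z ∈ region ↔ z ∈ region
  /-- The region contains a horoball neighbourhood of the puncture. -/
  exists_horoball : ∃ M : ℝ, ∀ z : UpperHalfPlane, M ≤ z.im → z ∈ region
  /-- The puncture is the only end of the region: it stays away from the other end of the
  cylinder. -/
  exists_im_lower_bound : ∃ ε : ℝ, 0 < ε ∧ ∀ z ∈ region, ε ≤ z.im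
  /-- The boundary closes up after `p` sides. -/
  vertex_add : ∀ i : ℤ, vertex (i + p) = (1 : ℝ) +ᵥ vertex i
  /-- The sides are nondegenerate. -/
  vertex_ne : ∀ i : ℤ, vertex i ≠ vertex (i + 1)
  /-- Consecutive sides meet only in their common vertex. -/
  side_inter_side : ∀ i : ℤ,
    geodesicSegment (vertex i) (vertex (i + 1)) ∩
      geodesicSegment (vertex (i + 1)) (vertex (i + 2)) = {vertex (i + 1)}
  /-- Other pairs of distinct sides are disjoint. -/
  side_disjoint : ∀ i j : ℤ, i + 1 < j →
    Disjoint (geodesicSegment (vertex i) (vertex (i + 1)))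
      (geodesicSegment (vertex j) (vertex (j + 1)))
  /-- The boundary of the region is the union of the sides. -/
  frontier_region : frontier region = ⋃ i : ℤ, geodesicSegment (vertex i) (vertex (i + 1))

namespace PolygonalCusp

/-- The hyperbolic length of the `i`-th side. -/
noncomputable def sideLength {p : ℕ} (P : PolygonalCusp p) (i : ℤ) : ℝ :=
  dist (P.vertex i) (P.vertex (i + 1))

/-- The sum of the lengths of the `p` sides of the boundary curve in the cylinder. -/
noncomputable def perimeter {p : ℕ} (P : PolygonalCusp p) : ℝ :=
  ∑ i ∈ Finset.range p, P.sideLength (i : ℤ)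

/-- The hyperbolic area of the region in the cylinder: the invariant measure `dx dy / y ^ 2` of
the part of the preimage lying in the fundamental domain `0 ≤ x < 1` of `T`. -/
noncomputable def area {p : ℕ} (P : PolygonalCusp p) : ENNReal :=
  volume (P.region ∩ {z : UpperHalfPlane | 0 ≤ z.re ∧ z.re < 1})

/-- The interior angle at the `i`-th vertex, in `[0, 2π)`: the angle by which the direction of the
outgoing side has to be turned counterclockwise, that is, through the region, to reach the
direction of the preceding side. -/
noncomputable def interiorAngle {p : ℕ} (P : PolygonalCusp p) (i : ℤ) : ℝ :=
  toIcoMod Real.two_pi_pos 0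
    (Complex.arg (geodesicDirection (P.vertex i) (P.vertex (i - 1)) /
      geodesicDirection (P.vertex i) (P.vertex (i + 1))))

/-- All sides have the same length and all interior angles are equal. -/
def IsRegular {p : ℕ} (P : PolygonalCusp p) : Prop :=
  (∀ i j : ℤ, P.sideLength i = P.sideLength j) ∧
    ∀ i j : ℤ, P.interiorAngle i = P.interiorAngle j

end PolygonalCusp

/-!
The area of a cusp is controlled by the area lying above its sides. Every point of the region lies
on or above a point of the boundary curve, since the vertical ray from it down to the real axis
leaves the region; hence the area of the cusp is at most the sum over one period of the areas above
the `p` sides (`PolygonalCusp.area_le_sum_volume_aboveSet`). Only the lower envelope of the curve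
matters here, so no form of the Jordan curve theorem is needed.

A side which is an arc of a semicircle centred on the real axis has above it an area equal to the
angle it subtends at the centre (`volume_aboveSet`). For a side of length `l` this angle is at most
`2 * arctan (sinh (l / 2))`, with equality exactly when both ends have the same height
(`exists_volume_aboveSet_of_re_lt`). That function of `l` is increasing and strictly concave, so Jensen's
inequality bounds the area of a cusp by `p` times its value at `perimeter / p`
(`PolygonalCusp.area_le_maxAreaAbove`). In the case of equality all sides have the same length and
all vertices the same height, so the vertices are equally spaced on a horocycle and the cusp is
regular (`PolygonalCusp.isUniform_of_im_eq`).

Conversely, in a regular cusp a Möbius transformation `g` shifts the sequence of vertices by one.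
Then `g` commutes with `z ↦ z + 1` at a vertex, which forces it to be a translation
(`PolygonalCusp.IsRegular.isUniform`). So the vertices are again equally spaced on a horocycle, the
boundary is a graph, and the bound for the area is attained (`PolygonalCusp.IsUniform.area_eq`).
Regular cusps of every area in `(0, p π)` are obtained from the exterior of a periodic family of
circles (`PolygonalCusp.exists_isUniform_area_eq`).
-/

/-! ### Hyperbolic geometry of a single segment and of its central angle -/

lemma geodesicSegment_comm (z w : UpperHalfPlane) : geodesicSegment z w = geodesicSegment w z := by
  ext x
  change dist z x + dist x w = dist z w ↔ dist w x + dist x z = dist w z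
  rw [add_comm, dist_comm x w, dist_comm z x, dist_comm z w]

lemma left_mem_geodesicSegment (z w : UpperHalfPlane) : z ∈ geodesicSegment z w := by
  simp [geodesicSegment]

lemma right_mem_geodesicSegment (z w : UpperHalfPlane) : w ∈ geodesicSegment z w := by
  simp [geodesicSegment]

/-- Up to a factor, the determinant of three points seen as vectors of the hyperboloid model. It is
the determinant of the rows `(|z| ^ 2, re z, 1)`, so it vanishes exactly when the points lie on a
common geodesic. -/
noncomputable def geodesicDet (z x w : UpperHalfPlane) : ℝ :=
  (z.re ^ 2 + z.im ^ 2) * (x.re - w.re) + (x.re ^ 2 + x.im ^ 2) * (w.re - z.re) +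
    (w.re ^ 2 + w.im ^ 2) * (z.re - x.re)

/-- The Gram determinant of three points of the hyperboloid model, computed from their distances
and from their coordinates. -/
lemma cosh_dist_sub_mul_sq (z x w : UpperHalfPlane) :
    (Real.cosh (dist z w) - Real.cosh (dist z x) * Real.cosh (dist x w)) ^ 2 =
      (Real.sinh (dist z x) * Real.sinh (dist x w)) ^ 2 -
        geodesicDet z x w ^ 2 / (4 * z.im ^ 2 * x.im ^ 2 * w.im ^ 2) := by
  have hz := z.im_pos.ne'
  have hx := x.im_pos.ne'
  have hw := w.im_pos.ne'
  rw [mul_pow, Real.sinh_sq, Real.sinh_sq]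
  simp only [UpperHalfPlane.cosh_dist', geodesicDet]
  field_simp
  ring

/-- Equality in the triangle inequality `dist z w ≤ dist z x + dist x w` amounts to
`cosh (dist z w) = cosh (dist z x + dist x w)`. Squaring turns this into the vanishing of a
determinant and a sign condition, which says that `x` lies between `z` and `w`. -/
lemma mem_geodesicSegment_iff (z w x : UpperHalfPlane) :
    x ∈ geodesicSegment z w ↔ geodesicDet z x w = 0 ∧
      Real.cosh (dist z x) * Real.cosh (dist x w) ≤ Real.cosh (dist z w) := by
  have key := cosh_dist_sub_mul_sq z x w
  have hz := z.im_pos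
  have hx := x.im_pos
  have hw := w.im_pos
  have hs : 0 ≤ Real.sinh (dist z x) * Real.sinh (dist x w) :=
    mul_nonneg (Real.sinh_nonneg_iff.2 dist_nonneg) (Real.sinh_nonneg_iff.2 dist_nonneg)
  constructor
  · intro h
    have h : dist z x + dist x w = dist z w := h
    have h1 : Real.cosh (dist z w) - Real.cosh (dist z x) * Real.cosh (dist x w) =
        Real.sinh (dist z x) * Real.sinh (dist x w) := by
      rw [← h, Real.cosh_add]; ring
    rw [h1] at key
    refine ⟨?_, by linarith⟩
    have h2 : geodesicDet z x w ^ 2 / (4 * z.im ^ 2 * x.im ^ 2 * w.im ^ 2) = 0 := by linarith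
    rw [div_eq_zero_iff] at h2
    rcases h2 with h2 | h2
    · exact pow_eq_zero_iff two_ne_zero |>.1 h2
    · exact absurd h2 (by positivity)
  · rintro ⟨h0, h1⟩
    rw [h0] at key
    have h2 : Real.cosh (dist z w) - Real.cosh (dist z x) * Real.cosh (dist x w) =
        Real.sinh (dist z x) * Real.sinh (dist x w) :=
      (sq_eq_sq₀ (by linarith) hs).1 (by rw [key]; simp)
    have h3 : Real.cosh (dist z w) = Real.cosh (dist z x + dist x w) := by
      rw [Real.cosh_add]; linarith
    have h4 := Real.cosh_injOn (Set.mem_Ici.2 dist_nonneg)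
      (Set.mem_Ici.2 (add_nonneg dist_nonneg dist_nonneg)) h3
    exact h4.symm

lemma re_eq_of_mem_geodesicSegment {z w x : UpperHalfPlane} (h : z.re = w.re)
    (hx : x ∈ geodesicSegment z w) : x.re = z.re := by
  by_contra hne
  obtain ⟨h0, h1⟩ := (mem_geodesicSegment_iff z w x).1 hx
  have h2 : (z.im ^ 2 - w.im ^ 2) * (x.re - w.re) = 0 := by
    unfold geodesicDet at h0; rw [h] at h0; linarith
  have h3 : z.im = w.im := by
    rcases mul_eq_zero.1 h2 with h2 | h2
    · exact (sq_eq_sq₀ z.im_pos.le w.im_pos.le).1 (by linarith)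
    · exact absurd (by linarith) hne
  have hzw : z = w := UpperHalfPlane.ext_re_im h h3
  subst hzw
  have hx' : dist z x + dist x z = dist z z := hx
  rw [dist_self, dist_comm x z] at hx'
  have : z = x := dist_eq_zero.1 (by linarith)
  exact hne (by rw [this])

/-- Two points with different real parts lie on a semicircle centred on the real axis. -/
lemma exists_center {z w : UpperHalfPlane} (h : z.re ≠ w.re) :
    ∃ c r : ℝ, 0 < r ∧ (z.re - c) ^ 2 + z.im ^ 2 = r ^ 2 ∧ (w.re - c) ^ 2 + w.im ^ 2 = r ^ 2 := by
  have h' : w.re - z.re ≠ 0 := sub_ne_zero.2 h.symm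
  set c := (w.re ^ 2 + w.im ^ 2 - z.re ^ 2 - z.im ^ 2) / (2 * (w.re - z.re)) with hc
  have hc' : c * (2 * (w.re - z.re)) = w.re ^ 2 + w.im ^ 2 - z.re ^ 2 - z.im ^ 2 := by
    rw [hc]; field_simp
  have hpos : 0 < (z.re - c) ^ 2 + z.im ^ 2 := by have := z.im_pos; positivity
  refine ⟨c, √((z.re - c) ^ 2 + z.im ^ 2), Real.sqrt_pos.2 hpos, ?_, ?_⟩
  · rw [Real.sq_sqrt hpos.le]
  · rw [Real.sq_sqrt hpos.le]; linarith

/-- The geodesic segment joining two points which are not on a vertical line is an arc of a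
semicircle centred on the real axis. -/
lemma mem_geodesicSegment_iff_of_circle {z w x : UpperHalfPlane} {c r : ℝ} (h : z.re < w.re)
    (hz : (z.re - c) ^ 2 + z.im ^ 2 = r ^ 2) (hw : (w.re - c) ^ 2 + w.im ^ 2 = r ^ 2) :
    x ∈ geodesicSegment z w ↔
      (x.re - c) ^ 2 + x.im ^ 2 = r ^ 2 ∧ z.re ≤ x.re ∧ x.re ≤ w.re := by
  have hzi := z.im_pos
  have hxi := x.im_pos
  have hwi := w.im_pos
  have hr : 0 < r ^ 2 := by rw [← hz]; positivity
  rw [mem_geodesicSegment_iff]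
  have hD : geodesicDet z x w = ((x.re - c) ^ 2 + x.im ^ 2 - r ^ 2) * (w.re - z.re) := by
    have e1 : z.re ^ 2 + z.im ^ 2 = r ^ 2 - c ^ 2 + 2 * c * z.re := by linarith
    have e2 : w.re ^ 2 + w.im ^ 2 = r ^ 2 - c ^ 2 + 2 * c * w.re := by linarith
    unfold geodesicDet
    rw [e1, e2]; ring
  rw [hD, mul_eq_zero, or_iff_left (sub_ne_zero.2 h.ne'), sub_eq_zero]
  refine and_congr_right fun hx => ?_
  have e : Real.cosh (dist z w) - Real.cosh (dist z x) * Real.cosh (dist x w) =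
      r ^ 2 * ((x.re - z.re) * (w.re - x.re)) / (z.im * x.im ^ 2 * w.im) := by
    simp only [UpperHalfPlane.cosh_dist']
    have e1 : (z.re - w.re) ^ 2 + z.im ^ 2 + w.im ^ 2 =
      2 * (r ^ 2 - (z.re - c) * (w.re - c)) := by linear_combination hz + hw
    have e2 : (z.re - x.re) ^ 2 + z.im ^ 2 + x.im ^ 2 =
      2 * (r ^ 2 - (z.re - c) * (x.re - c)) := by linear_combination hz + hx
    have e3 : (x.re - w.re) ^ 2 + x.im ^ 2 + w.im ^ 2 =
      2 * (r ^ 2 - (x.re - c) * (w.re - c)) := by linear_combination hx + hw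
    rw [e1, e2, e3]
    field_simp
    linear_combination (r ^ 2 - (z.re - c) * (w.re - c)) * hx
  rw [← sub_nonneg, e]
  constructor
  · intro h1
    have h2 : 0 ≤ (x.re - z.re) * (w.re - x.re) := by
      by_contra hlt
      have : r ^ 2 * ((x.re - z.re) * (w.re - x.re)) / (z.im * x.im ^ 2 * w.im) < 0 :=
        div_neg_of_neg_of_pos (mul_neg_of_pos_of_neg hr (not_le.1 hlt)) (by positivity)
      linarith
    constructor <;> nlinarith
  · rintro ⟨h1, h2⟩
    have := mul_nonneg (sub_nonneg.2 h1) (sub_nonneg.2 h2)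
    positivity

/-- The largest possible area above a geodesic segment of length `l`: it is the area above a segment
whose ends have the same height. -/
noncomputable def maxAreaAbove (l : ℝ) : ℝ := 2 * Real.arctan (Real.sinh (l / 2))

/-- The angle of an arc is bounded in terms of its hyperbolic length `l`. The numbers `a`, `b` are
the angles, measured from the vertical, at which the ends of the arc are seen from its centre. With
`d = (b - a) / 2` and `s = (a + b) / 2` one has `sinh (l / 2) ^ 2 =
sin d ^ 2 / (cos d ^ 2 - sin s ^ 2)`, which is at least `tan d ^ 2`. -/
lemma sub_le_maxAreaAbove {a b l : ℝ} (ha : a ∈ Set.Ioo (-(Real.pi / 2)) (Real.pi / 2))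
    (hb : b ∈ Set.Ioo (-(Real.pi / 2)) (Real.pi / 2)) (hab : a < b) (hl : 0 ≤ l)
    (h : Real.cosh l = (1 - Real.sin a * Real.sin b) / (Real.cos a * Real.cos b)) :
    b - a ≤ maxAreaAbove l ∧ (b - a = maxAreaAbove l ↔ a = -b) := by
  have hca := Real.cos_pos_of_mem_Ioo ha
  have hcb := Real.cos_pos_of_mem_Ioo hb
  set s := (a + b) / 2 with hs
  set d := (b - a) / 2 with hd
  have ea : a = s - d := by rw [hs, hd]; ring
  have eb : b = s + d := by rw [hs, hd]; ring
  have hd0 : 0 < d := by rw [hd]; linarith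
  have hd1 : d < Real.pi / 2 := by rw [hd]; linarith [ha.1, hb.2]
  have hs1 : s ∈ Set.Ioo (-(Real.pi / 2)) (Real.pi / 2) := by
    constructor <;> rw [hs] <;> linarith [ha.1, hb.2, ha.2, hb.1]
  have hcd : 0 < Real.cos d := Real.cos_pos_of_mem_Ioo ⟨by linarith [Real.pi_pos], hd1⟩
  have hsd : 0 < Real.sin d := Real.sin_pos_of_pos_of_lt_pi hd0 (by linarith [Real.pi_pos])
  have hprod : Real.cos a * Real.cos b = Real.cos d ^ 2 - Real.sin s ^ 2 := by
    rw [ea, eb, Real.cos_sub, Real.cos_add]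
    linear_combination (Real.cos d) ^ 2 * Real.cos_sq_add_sin_sq s -
      Real.sin s ^ 2 * Real.cos_sq_add_sin_sq d
  have hprod' : 1 - Real.sin a * Real.sin b = Real.cos a * Real.cos b + 2 * Real.sin d ^ 2 := by
    rw [ea, eb, Real.cos_sub, Real.cos_add, Real.sin_sub, Real.sin_add]
    have := Real.cos_sq_add_sin_sq s
    have := Real.cos_sq_add_sin_sq d
    have e : Real.cos d ^ 2 = 1 - Real.sin d ^ 2 := by linarith
    have e' : Real.cos s ^ 2 = 1 - Real.sin s ^ 2 := by linarith
    ring_nf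
    rw [e, e']; ring
  have hden : 0 < Real.cos d ^ 2 - Real.sin s ^ 2 := hprod ▸ mul_pos hca hcb
  have hsinh : Real.sinh (l / 2) ^ 2 = Real.sin d ^ 2 / (Real.cos d ^ 2 - Real.sin s ^ 2) := by
    have h1 : Real.cosh l = 2 * Real.sinh (l / 2) ^ 2 + 1 := by
      have := Real.cosh_two_mul (l / 2)
      rw [mul_div_cancel₀ _ two_ne_zero, Real.cosh_sq] at this
      linarith
    rw [h1, hprod', hprod, add_div, div_self hden.ne'] at h
    linear_combination h / 2
  have hsh : 0 ≤ Real.sinh (l / 2) := Real.sinh_nonneg_iff.2 (by linarith)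
  have htan : Real.tan d ^ 2 = Real.sin d ^ 2 / Real.cos d ^ 2 := by
    rw [Real.tan_eq_sin_div_cos, div_pow]
  have htan0 : 0 ≤ Real.tan d := (Real.tan_pos_of_pos_of_lt_pi_div_two hd0 hd1).le
  have hatan : Real.arctan (Real.tan d) = d :=
    Real.arctan_tan (by linarith [Real.pi_pos]) hd1
  have hle : Real.tan d ≤ Real.sinh (l / 2) := by
    rw [← sq_le_sq₀ htan0 hsh, htan, hsinh]
    exact div_le_div_of_nonneg_left (sq_nonneg _) hden (by linarith [sq_nonneg (Real.sin s)])
  have e2 : b - a = 2 * Real.arctan (Real.tan d) := by rw [hatan, hd]; ring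
  refine ⟨?_, ?_⟩
  · rw [e2, maxAreaAbove]
    linarith [Real.arctan_strictMono.monotone hle]
  · rw [e2, maxAreaAbove]
    constructor
    · intro h3
      have h4 : Real.tan d = Real.sinh (l / 2) := Real.arctan_injective (by linarith)
      rw [← sq_eq_sq₀ htan0 hsh, htan, hsinh, div_eq_div_iff (by positivity) hden.ne'] at h4
      have h5 : Real.sin d ^ 2 * Real.sin s ^ 2 = 0 := by linarith
      have h6 : Real.sin s = 0 := by
        rcases mul_eq_zero.1 h5 with h5 | h5
        · exact absurd h5 (by positivity)
        · exact pow_eq_zero_iff two_ne_zero |>.1 h5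
      have h7 := (Real.sin_eq_zero_iff_of_lt_of_lt (by linarith [hs1.1, Real.pi_pos])
        (by linarith [hs1.2, Real.pi_pos])).1 h6
      linarith
    · intro h3
      have h4 : s = 0 := by rw [hs]; linarith
      have h5 : Real.tan d = Real.sinh (l / 2) := by
        rw [← sq_eq_sq₀ htan0 hsh, htan, hsinh, h4]; simp
      rw [h5]

lemma hasDerivAt_maxAreaAbove (l : ℝ) :
    HasDerivAt maxAreaAbove (1 / Real.cosh (l / 2)) l := by
  have h1 : HasDerivAt (fun l : ℝ => l / 2) (1 / 2) l := (hasDerivAt_id l).div_const 2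
  have h2 := ((h1.sinh).arctan).const_mul 2
  refine h2.congr_deriv ?_
  have := (Real.cosh_pos (l / 2)).ne'
  rw [add_comm, ← Real.cosh_sq]
  field_simp

lemma strictMono_maxAreaAbove : StrictMono maxAreaAbove := by
  intro a b h
  unfold maxAreaAbove
  have := Real.arctan_strictMono (Real.sinh_strictMono (by linarith : a / 2 < b / 2))
  linarith

lemma strictConcaveOn_maxAreaAbove : StrictConcaveOn ℝ (Set.Ici 0) maxAreaAbove := by
  apply StrictAntiOn.strictConcaveOn_of_deriv (convex_Ici 0)
  · exact fun x _ => (hasDerivAt_maxAreaAbove x).continuousAt.continuousWithinAt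
  · intro a ha b hb hab
    rw [interior_Ici] at ha hb
    simp only [(hasDerivAt_maxAreaAbove _).deriv]
    have ha : 0 < a := ha
    refine one_div_lt_one_div_of_lt (Real.cosh_pos _) (Real.cosh_lt_cosh.2 ?_)
    rw [abs_of_pos (by linarith), abs_of_pos (by linarith)]
    linarith

lemma maxAreaAbove_zero : maxAreaAbove 0 = 0 := by simp [maxAreaAbove]

lemma maxAreaAbove_nonneg {l : ℝ} (h : 0 ≤ l) : 0 ≤ maxAreaAbove l :=
  maxAreaAbove_zero ▸ strictMono_maxAreaAbove.monotone h

lemma maxAreaAbove_lt_pi (l : ℝ) : maxAreaAbove l < Real.pi := by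
  have := Real.arctan_lt_pi_div_two (Real.sinh (l / 2))
  unfold maxAreaAbove; linarith

/-! ### Area above a segment, and unfolding over the fundamental strip -/

/-- The points lying on or vertically above a point of `S`. -/
def aboveSet (S : Set UpperHalfPlane) : Set UpperHalfPlane :=
  {q | ∃ s ∈ S, s.re = q.re ∧ s.im ≤ q.im}

lemma lintegral_Ici_one_div_sq {a : ℝ} (ha : 0 < a) :
    ∫⁻ y in Set.Ici a, ENNReal.ofReal (1 / y ^ 2) = ENNReal.ofReal (1 / a) := by
  rw [setLIntegral_congr Ioi_ae_eq_Ici.symm]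
  have h1 : ∀ y ∈ Set.Ioi a, (1 : ℝ) / y ^ 2 = y ^ (-2 : ℝ) := by
    intro y hy
    rw [Real.rpow_neg (ha.trans hy).le, one_div]
    norm_cast
  rw [setLIntegral_congr_fun measurableSet_Ioi (fun y hy => by rw [h1 y hy]),
    ← ofReal_integral_eq_lintegral_ofReal, integral_Ioi_rpow_of_lt (by norm_num) ha]
  · congr 1
    norm_num
    rw [Real.rpow_neg ha.le, Real.rpow_one]
  · exact integrableOn_Ioi_rpow_of_lt (by norm_num) ha
  · filter_upwards [ae_restrict_mem measurableSet_Ioi] with y hy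
    exact Real.rpow_nonneg (ha.trans hy).le _

/-- The hyperbolic area above a graph `y = f x` is the integral of `1 / f`. -/
lemma volume_above_graph {I : Set ℝ} (hI : MeasurableSet I) {f : ℝ → ℝ} (hf : Measurable f)
    (hpos : ∀ x ∈ I, 0 < f x) :
    volume {q : UpperHalfPlane | q.re ∈ I ∧ f q.re ≤ q.im} =
      ∫⁻ x in I, ENNReal.ofReal (1 / f x) := by
  have himg : (UpperHalfPlane.coe '' {q : UpperHalfPlane | q.re ∈ I ∧ f q.re ≤ q.im}) =
      {z : ℂ | z.re ∈ I ∧ f z.re ≤ z.im} := by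
    ext z
    constructor
    · rintro ⟨q, hq, rfl⟩
      exact hq
    · rintro ⟨h1, h2⟩
      exact ⟨⟨z, (hpos _ h1).trans_le h2⟩, ⟨h1, h2⟩, rfl⟩
  have hmS : MeasurableSet {z : ℝ × ℝ | z.1 ∈ I ∧ f z.1 ≤ z.2} :=
    (measurable_fst hI).inter (measurableSet_le (hf.comp measurable_fst) measurable_snd)
  have hpre : {z : ℂ | z.re ∈ I ∧ f z.re ≤ z.im} =
      Complex.measurableEquivRealProd ⁻¹' {z : ℝ × ℝ | z.1 ∈ I ∧ f z.1 ≤ z.2} := rfl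
  have hfun : ∀ z : ℂ, (((1 / ‖z.im‖₊) ^ 2 : NNReal) : ENNReal) =
      (fun w : ℝ × ℝ => ENNReal.ofReal (1 / w.2 ^ 2)) (Complex.measurableEquivRealProd z) := by
    intro z
    change _ = ENNReal.ofReal (1 / z.im ^ 2)
    rw [ENNReal.ofReal, ENNReal.coe_inj]
    ext
    rw [Real.coe_toNNReal _ (by positivity)]
    simp
  rw [UpperHalfPlane.volume_eq_lintegral, himg, hpre]
  rw [lintegral_congr hfun]
  refine (Complex.volume_preserving_equiv_real_prod.setLIntegral_comp_preimage hmS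
    (f := fun w : ℝ × ℝ => ENNReal.ofReal (1 / w.2 ^ 2)) (by fun_prop)).trans ?_
  rw [← lintegral_indicator hmS, Measure.volume_eq_prod, lintegral_prod _ (by
      refine (Measurable.indicator (by fun_prop) hmS).aemeasurable),
    ← lintegral_indicator hI]
  congr 1
  ext x
  by_cases hx : x ∈ I
  · rw [Set.indicator_of_mem hx, ← lintegral_Ici_one_div_sq (hpos x hx),
      ← lintegral_indicator measurableSet_Ici]
    congr 1
    ext y
    by_cases hy : f x ≤ y
    · rw [Set.indicator_of_mem (show (x, y) ∈ {z : ℝ × ℝ | z.1 ∈ I ∧ f z.1 ≤ z.2} from ⟨hx, hy⟩),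
        Set.indicator_of_mem (Set.mem_Ici.2 hy)]
    · rw [Set.indicator_of_notMem (fun h => hy h.2), Set.indicator_of_notMem (mt Set.mem_Ici.1 hy)]
  · rw [Set.indicator_of_notMem hx]
    refine (lintegral_congr fun y => ?_).trans lintegral_zero
    exact Set.indicator_of_notMem (fun h => hx h.1) _

lemma volume_verticalLine (a : ℝ) : volume {q : UpperHalfPlane | q.re = a} = 0 := by
  rw [UpperHalfPlane.volume_eq_lintegral]
  apply setLIntegral_measure_zero
  refine measure_mono_null (t := Complex.measurableEquivRealProd ⁻¹' ({a} ×ˢ Set.univ)) ?_ ?_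
  · rintro _ ⟨q, hq, rfl⟩
    exact ⟨hq, trivial⟩
  · rw [Complex.volume_preserving_equiv_real_prod.measure_preimage
      ((measurableSet_singleton a).prod MeasurableSet.univ).nullMeasurableSet,
      Measure.volume_eq_prod, Measure.prod_prod]
    simp

lemma aboveSet_geodesicSegment {z w : UpperHalfPlane} {c r : ℝ} (h : z.re < w.re)
    (hz : (z.re - c) ^ 2 + z.im ^ 2 = r ^ 2) (hw : (w.re - c) ^ 2 + w.im ^ 2 = r ^ 2) :
    aboveSet (geodesicSegment z w) =
      {q | q.re ∈ Set.Icc z.re w.re ∧ √(r ^ 2 - (q.re - c) ^ 2) ≤ q.im} := by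
  ext q
  constructor
  · rintro ⟨s, hs, h1, h2⟩
    obtain ⟨h3, h4⟩ := (mem_geodesicSegment_iff_of_circle h hz hw).1 hs
    rw [h1] at h3 h4
    refine ⟨h4, ?_⟩
    rwa [← h3, add_sub_cancel_left, Real.sqrt_sq s.im_pos.le]
  · rintro ⟨h1, h2⟩
    have hpos : 0 < r ^ 2 - (q.re - c) ^ 2 := by
      have := z.im_pos
      have := w.im_pos
      have := h1.1
      have := h1.2
      rcases le_total c q.re with h3 | h3 <;> nlinarith
    refine ⟨⟨⟨q.re, √(r ^ 2 - (q.re - c) ^ 2)⟩, Real.sqrt_pos.2 hpos⟩, ?_, rfl, h2⟩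
    rw [mem_geodesicSegment_iff_of_circle h hz hw]
    refine ⟨?_, h1⟩
    change (q.re - c) ^ 2 + √(r ^ 2 - (q.re - c) ^ 2) ^ 2 = r ^ 2
    rw [Real.sq_sqrt hpos.le]; ring

lemma measurableSet_aboveSet {z w : UpperHalfPlane} (h : z.re < w.re) :
    MeasurableSet (aboveSet (geodesicSegment z w)) := by
  obtain ⟨c, r, -, hz, hw⟩ := exists_center h.ne
  rw [aboveSet_geodesicSegment h hz hw]
  have hre : Measurable fun q : UpperHalfPlane => q.re := UpperHalfPlane.continuous_re.measurable
  have him : Measurable fun q : UpperHalfPlane => q.im := UpperHalfPlane.continuous_im.measurable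
  exact (hre measurableSet_Icc).inter (measurableSet_le (by fun_prop) him)

lemma hasDerivAt_arcsin_div {c r x : ℝ} (hr : 0 < r) (h : 0 < r ^ 2 - (x - c) ^ 2) :
    HasDerivAt (fun x => Real.arcsin ((x - c) / r)) (1 / √(r ^ 2 - (x - c) ^ 2)) x := by
  have h1 : |(x - c) / r| < 1 := by
    rw [abs_div, abs_of_pos hr, div_lt_one hr]
    exact abs_lt_of_sq_lt_sq (by linarith) hr.le
  rw [abs_lt] at h1
  have h2 : HasDerivAt (fun x => (x - c) / r) (1 / r) x :=
    ((hasDerivAt_id x).sub_const c).div_const r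
  refine ((Real.hasDerivAt_arcsin h1.1.ne' h1.2.ne).comp x h2).congr_deriv ?_
  have h3 : √(1 - ((x - c) / r) ^ 2) = √(r ^ 2 - (x - c) ^ 2) / r := by
    rw [show 1 - ((x - c) / r) ^ 2 = (r ^ 2 - (x - c) ^ 2) / r ^ 2 by field_simp,
      Real.sqrt_div h.le, Real.sqrt_sq hr.le]
  rw [h3]
  have := Real.sqrt_pos.2 h
  field_simp

/-- The area above an arc is the angle which the arc subtends at its centre. -/
lemma volume_aboveSet {z w : UpperHalfPlane} {c r : ℝ} (hr : 0 < r) (h : z.re < w.re)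
    (hz : (z.re - c) ^ 2 + z.im ^ 2 = r ^ 2) (hw : (w.re - c) ^ 2 + w.im ^ 2 = r ^ 2) :
    volume (aboveSet (geodesicSegment z w)) =
      ENNReal.ofReal (Real.arcsin ((w.re - c) / r) - Real.arcsin ((z.re - c) / r)) := by
  have hpos : ∀ x ∈ Set.Icc z.re w.re, 0 < r ^ 2 - (x - c) ^ 2 := by
    intro x h1
    have := z.im_pos
    have := w.im_pos
    have := h1.1
    have := h1.2
    rcases le_total c x with h3 | h3 <;> nlinarith
  rw [aboveSet_geodesicSegment h hz hw, volume_above_graph measurableSet_Icc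
    (f := fun x => √(r ^ 2 - (x - c) ^ 2)) (by fun_prop) (fun x hx => Real.sqrt_pos.2 (hpos x hx))]
  have hcont : ContinuousOn (fun x => 1 / √(r ^ 2 - (x - c) ^ 2)) (Set.Icc z.re w.re) := by
    refine ContinuousOn.div continuousOn_const (by fun_prop) fun x hx => ?_
    exact (Real.sqrt_pos.2 (hpos x hx)).ne'
  rw [← ofReal_integral_eq_lintegral_ofReal hcont.integrableOn_Icc
    (Filter.Eventually.of_forall fun x => by positivity), integral_Icc_eq_integral_Ioc,
    ← intervalIntegral.integral_of_le h.le]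
  congr 1
  refine intervalIntegral.integral_eq_sub_of_hasDerivAt
    (f := fun x => Real.arcsin ((x - c) / r)) (fun x hx => ?_) ?_
  · rw [Set.uIcc_of_le h.le] at hx
    exact hasDerivAt_arcsin_div hr (hpos x hx)
  · refine ContinuousOn.intervalIntegrable ?_
    rwa [Set.uIcc_of_le h.le]

/-- The part of the hyperbolic plane above a geodesic segment of length `l` has area at most
`maxAreaAbove l`, and the bound is attained by the segments with ends at the same height. -/
lemma exists_volume_aboveSet_of_re_lt {z w : UpperHalfPlane} (h : z.re < w.re) :
    ∃ a : ℝ, 0 ≤ a ∧ volume (aboveSet (geodesicSegment z w)) = ENNReal.ofReal a ∧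
      a ≤ maxAreaAbove (dist z w) ∧ (a = maxAreaAbove (dist z w) ↔ z.im = w.im) := by
  obtain ⟨c, r, hr, hz, hw⟩ := exists_center h.ne
  set a := Real.arcsin ((z.re - c) / r) with ha
  set b := Real.arcsin ((w.re - c) / r) with hb
  have hbd : ∀ q : UpperHalfPlane, (q.re - c) ^ 2 + q.im ^ 2 = r ^ 2 →
      -1 < (q.re - c) / r ∧ (q.re - c) / r < 1 := by
    intro q hq
    have := q.im_pos
    rw [lt_div_iff₀ hr, div_lt_one hr]
    constructor <;> nlinarith
  have hcos : ∀ q : UpperHalfPlane, (q.re - c) ^ 2 + q.im ^ 2 = r ^ 2 →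
      Real.cos (Real.arcsin ((q.re - c) / r)) = q.im / r := by
    intro q hq
    rw [Real.cos_arcsin, show 1 - ((q.re - c) / r) ^ 2 = (q.im / r) ^ 2 by
      field_simp; linarith, Real.sqrt_sq (div_nonneg q.im_pos.le hr.le)]
  have hsin : ∀ q : UpperHalfPlane, (q.re - c) ^ 2 + q.im ^ 2 = r ^ 2 →
      Real.sin (Real.arcsin ((q.re - c) / r)) = (q.re - c) / r := fun q hq =>
    Real.sin_arcsin (hbd q hq).1.le (hbd q hq).2.le
  have hmem : ∀ q : UpperHalfPlane, (q.re - c) ^ 2 + q.im ^ 2 = r ^ 2 →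
      Real.arcsin ((q.re - c) / r) ∈ Set.Ioo (-(Real.pi / 2)) (Real.pi / 2) := fun q hq =>
    ⟨Real.neg_pi_div_two_lt_arcsin.2 (hbd q hq).1, Real.arcsin_lt_pi_div_two.2 (hbd q hq).2⟩
  have hab : a < b := by
    refine Real.strictMonoOn_arcsin ⟨(hbd z hz).1.le, (hbd z hz).2.le⟩
      ⟨(hbd w hw).1.le, (hbd w hw).2.le⟩ ?_
    exact div_lt_div_of_pos_right (by linarith) hr
  have hcosh : Real.cosh (dist z w) =
      (1 - Real.sin a * Real.sin b) / (Real.cos a * Real.cos b) := by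
    rw [ha, hb, hcos z hz, hcos w hw, hsin z hz, hsin w hw, UpperHalfPlane.cosh_dist']
    have e1 : (z.re - w.re) ^ 2 + z.im ^ 2 + w.im ^ 2 =
      2 * (r ^ 2 - (z.re - c) * (w.re - c)) := by linear_combination hz + hw
    rw [e1]
    field_simp
  obtain ⟨h1, h2⟩ := sub_le_maxAreaAbove (hmem z hz) (hmem w hw) hab dist_nonneg hcosh
  refine ⟨b - a, by linarith, volume_aboveSet hr h hz hw, h1, h2.trans ?_⟩
  rw [← Real.arcsin_neg]
  constructor
  · intro h3
    have h4 : Real.cos a = Real.cos b := by rw [ha, h3, Real.arcsin_neg, Real.cos_neg]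
    rw [ha, hb, hcos z hz, hcos w hw] at h4
    exact (div_left_inj' hr.ne').1 h4
  · intro h3
    have h4 : (z.re - c) ^ 2 = (w.re - c) ^ 2 := by rw [h3] at hz; linarith
    rcases sq_eq_sq_iff_eq_or_eq_neg.1 h4 with h5 | h5
    · linarith
    · rw [h5, neg_div]

/-- The bound for the area above a segment, including vertical segments, above which there is only
a null set. -/
lemma exists_volume_aboveSet {z w : UpperHalfPlane} (hzw : z ≠ w) :
    ∃ a : ℝ, 0 ≤ a ∧ volume (aboveSet (geodesicSegment z w)) = ENNReal.ofReal a ∧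
      a ≤ maxAreaAbove (dist z w) ∧ (a = maxAreaAbove (dist z w) → z.im = w.im) := by
  rcases lt_trichotomy z.re w.re with h | h | h
  · obtain ⟨a, h1, h2, h3, h4⟩ := exists_volume_aboveSet_of_re_lt h
    exact ⟨a, h1, h2, h3, h4.1⟩
  · have hpos : 0 < maxAreaAbove (dist z w) :=
      maxAreaAbove_zero ▸ strictMono_maxAreaAbove (dist_pos.2 hzw)
    refine ⟨0, le_rfl, ?_, hpos.le, fun h0 => absurd h0 hpos.ne⟩
    rw [ENNReal.ofReal_zero]
    refine measure_mono_null ?_ (volume_verticalLine z.re)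
    rintro q ⟨s, hs, h1, -⟩
    exact h1.symm.trans (re_eq_of_mem_geodesicSegment h hs)
  · obtain ⟨a, h1, h2, h3, h4⟩ := exists_volume_aboveSet_of_re_lt h
    rw [geodesicSegment_comm, dist_comm]
    exact ⟨a, h1, h2, h3, fun e => (h4.1 e).symm⟩

lemma re_mem_Icc_of_mem_aboveSet {z w q : UpperHalfPlane} (h : z.re < w.re)
    (hq : q ∈ aboveSet (geodesicSegment z w)) : q.re ∈ Set.Icc z.re w.re := by
  obtain ⟨c, r, -, hz, hw⟩ := exists_center h.ne
  rw [aboveSet_geodesicSegment h hz hw] at hq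
  exact hq.1

lemma volume_preimage_vadd (n : ℤ) (S : Set UpperHalfPlane) :
    volume ((fun z : UpperHalfPlane => (n : ℝ) +ᵥ z) ⁻¹' S) = volume S := by
  have : (fun z : UpperHalfPlane => (n : ℝ) +ᵥ z) = fun z =>
      (((ModularGroup.T ^ n : Matrix.SpecialLinearGroup (Fin 2) ℤ) : GL (Fin 2) ℝ)) • z := by
    ext1 z
    rw [← UpperHalfPlane.modular_T_zpow_smul]
    rfl
  rw [this, measure_preimage_smul]

/-- A vertical strip of width one. -/
def unitStrip (k : ℤ) : Set UpperHalfPlane := {z | (k : ℝ) ≤ z.re ∧ z.re < k + 1}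

lemma measurableSet_unitStrip (k : ℤ) : MeasurableSet (unitStrip k) :=
  UpperHalfPlane.continuous_re.measurable measurableSet_Ico

lemma volume_eq_tsum_strip (S : Set UpperHalfPlane) :
    volume S = ∑' k : ℤ, volume (S ∩ unitStrip k) := by
  have hU : ⋃ k, unitStrip k = Set.univ := by
    refine Set.eq_univ_of_forall fun z => Set.mem_iUnion.2 ⟨⌊z.re⌋, ?_⟩
    exact ⟨Int.floor_le _, Int.lt_floor_add_one _⟩
  have hd : Pairwise (Function.onFun Disjoint unitStrip) := by
    intro i j hij
    refine Set.disjoint_left.2 fun z hi hj => hij ?_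
    rw [← Int.floor_eq_iff.2 hi, ← Int.floor_eq_iff.2 hj]
  have h1 := measure_iUnion (μ := volume.restrict S) hd measurableSet_unitStrip
  rw [hU, Measure.restrict_apply_univ] at h1
  rw [h1]
  refine tsum_congr fun k => ?_
  rw [Measure.restrict_apply (measurableSet_unitStrip k), Set.inter_comm]

/-- Unfolding: for a family of sets which is periodic modulo the translation, the areas of the
traces on one fundamental strip add up to the areas of the sets in one period. -/
lemma tsum_volume_inter_strip {p : ℕ} (hp : 1 ≤ p) (U : ℤ → Set UpperHalfPlane)
    (hU : ∀ (i k : ℤ) (z : UpperHalfPlane), (k : ℝ) +ᵥ z ∈ U (i + k * p) ↔ z ∈ U i) :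
    ∑' i : ℤ, volume (U i ∩ unitStrip 0) = ∑ i ∈ Finset.range p, volume (U (i : ℤ)) := by
  have : NeZero p := ⟨by omega⟩
  rw [← (Int.divModEquiv p).symm.tsum_eq,
    ENNReal.tsum_prod (f := fun k i => volume (U ((Int.divModEquiv p).symm (k, i)) ∩ unitStrip 0)),
    ENNReal.tsum_comm, tsum_fintype,
    Finset.sum_range]
  refine Finset.sum_congr rfl fun i _ => ?_
  rw [volume_eq_tsum_strip (U (i : ℕ)), ← (Equiv.neg ℤ).tsum_eq]
  refine tsum_congr fun k => ?_
  -- The translate by `-k` of the trace on the strip number `k` is a trace on the strip number `0`.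
  rw [← volume_preimage_vadd (-k)]
  congr 1
  ext z
  have h1 := hU (i : ℕ) (-k) z
  have h2 : (Int.divModEquiv p).symm (-k, i) = ((i : ℕ) : ℤ) + -k * p := by
    simp [Int.divModEquiv]; ring
  simp only [Equiv.neg_apply, Set.mem_preimage, Set.mem_inter_iff, h2, h1, unitStrip]
  refine and_congr_right fun _ => ?_
  simp only [Set.mem_ofPred_eq, UpperHalfPlane.vadd_re]
  push_cast
  constructor <;> rintro ⟨h3, h4⟩ <;> constructor <;> linarith

/-! ### Area and perimeter of polygonal cusps -/

lemma vadd_mem_geodesicSegment_iff (a : ℝ) (z w x : UpperHalfPlane) :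
    a +ᵥ x ∈ geodesicSegment (a +ᵥ z) (a +ᵥ w) ↔ x ∈ geodesicSegment z w := by
  have h := (UpperHalfPlane.isometry_real_vadd a).dist_eq
  change dist _ _ + dist _ _ = dist _ _ ↔ dist _ _ + dist _ _ = dist _ _
  rw [h, h, h]

lemma geodesicDirection_vadd (a : ℝ) (z w : UpperHalfPlane) :
    geodesicDirection (a +ᵥ z) (a +ᵥ w) = geodesicDirection z w := by
  simp only [geodesicDirection, UpperHalfPlane.coe_vadd, map_add, Complex.conj_ofReal,
    add_sub_add_left_eq_sub]

/-- A vertical segment meeting both a set and its complement meets the frontier of the set. -/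
lemma exists_mem_frontier_on_vertical {A : Set UpperHalfPlane} {x a b : ℝ} (ha : 0 < a)
    (h1 : ∃ z ∈ A, z.re = x ∧ a ≤ z.im ∧ z.im ≤ b)
    (h2 : ∃ z ∉ A, z.re = x ∧ a ≤ z.im ∧ z.im ≤ b) :
    ∃ z ∈ frontier A, z.re = x ∧ a ≤ z.im ∧ z.im ≤ b := by
  have hconn : IsPreconnected {z : UpperHalfPlane | z.re = x ∧ a ≤ z.im ∧ z.im ≤ b} := by
    have himg : {z : UpperHalfPlane | z.re = x ∧ a ≤ z.im ∧ z.im ≤ b} =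
        Set.range fun t : Set.Icc a b => (⟨⟨x, t⟩, ha.trans_le t.2.1⟩ : UpperHalfPlane) := by
      ext z
      constructor
      · rintro ⟨h1, h2⟩
        exact ⟨⟨z.im, h2⟩, UpperHalfPlane.ext_re_im h1.symm rfl⟩
      · rintro ⟨t, rfl⟩
        exact ⟨rfl, t.2⟩
    rw [himg]
    have : PreconnectedSpace (Set.Icc a b) := isPreconnected_iff_preconnectedSpace.1
      isPreconnected_Icc
    refine isPreconnected_range (UpperHalfPlane.isEmbedding_coe.continuous_iff.2 ?_)
    change Continuous fun t : Set.Icc a b => (⟨x, t⟩ : ℂ)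
    have : (fun t : Set.Icc a b => (⟨x, t⟩ : ℂ)) =
        fun t : Set.Icc a b => (x : ℂ) + (t : ℝ) * Complex.I := by
      ext1 t
      apply Complex.ext <;> simp
    rw [this]
    fun_prop
  obtain ⟨z, hz, h⟩ := h1
  obtain ⟨w, hw, h'⟩ := h2
  by_contra! hne
  have hcover : {z : UpperHalfPlane | z.re = x ∧ a ≤ z.im ∧ z.im ≤ b} ⊆
      interior A ∪ (closure A)ᶜ := by
    intro q hq
    by_cases hc : q ∈ closure A
    · left
      by_contra hi
      exact absurd hq.2.2 (not_le.2 (hne q ⟨hc, hi⟩ hq.1 hq.2.1))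
    · exact Or.inr hc
  have hz' : z ∈ interior A := (hcover h).resolve_right fun h => h (subset_closure hz)
  have hw' : w ∈ (closure A)ᶜ := (hcover h').resolve_left fun h => hw (interior_subset h)
  obtain ⟨q, -, h1, h2⟩ := hconn _ _ isOpen_interior isClosed_closure.isOpen_compl hcover
    ⟨z, h, hz'⟩ ⟨w, h', hw'⟩
  exact h2 (interior_subset_closure h1)

namespace PolygonalCusp

variable {p : ℕ}

/-- The lift of a side of the boundary curve. -/
def side (P : PolygonalCusp p) (i : ℤ) : Set UpperHalfPlane :=
  geodesicSegment (P.vertex i) (P.vertex (i + 1))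

lemma vertex_add_mul (P : PolygonalCusp p) (i k : ℤ) :
    P.vertex (i + k * p) = (k : ℝ) +ᵥ P.vertex i := by
  induction k using Int.induction_on with
  | zero => simp
  | succ k ih =>
    have : i + ((k : ℤ) + 1) * p = (i + k * p) + p := by ring
    rw [this, P.vertex_add, ih, vadd_vadd]
    push_cast
    rw [add_comm]
  | pred k ih =>
    have h := P.vertex_add (i + (-(k : ℤ) - 1) * p)
    have e : i + (-(k : ℤ) - 1) * p + p = i + -(k : ℤ) * p := by ring
    rw [e, ih] at h
    have h' := congrArg (fun z : UpperHalfPlane => (-1 : ℝ) +ᵥ z) h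
    simp only [vadd_vadd] at h'
    rw [neg_add_cancel, zero_vadd] at h'
    rw [← h']
    push_cast
    congr 1
    ring

lemma vadd_mem_aboveSet_side_iff (P : PolygonalCusp p) (i k : ℤ) (z : UpperHalfPlane) :
    (k : ℝ) +ᵥ z ∈ aboveSet (P.side (i + k * p)) ↔ z ∈ aboveSet (P.side i) := by
  have h : ∀ x, (k : ℝ) +ᵥ x ∈ P.side (i + k * p) ↔ x ∈ P.side i := by
    intro x
    have e : i + k * p + 1 = (i + 1) + k * p := by ring
    rw [side, e, vertex_add_mul, vertex_add_mul, vadd_mem_geodesicSegment_iff, side]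
  constructor
  · rintro ⟨s, hs, h1, h2⟩
    refine ⟨(-k : ℝ) +ᵥ s, ?_, ?_, ?_⟩
    · rw [← h, vadd_vadd, add_neg_cancel, zero_vadd]; exact hs
    · rw [UpperHalfPlane.vadd_re, h1, UpperHalfPlane.vadd_re]; ring
    · simpa using h2
  · rintro ⟨s, hs, h1, h2⟩
    refine ⟨(k : ℝ) +ᵥ s, (h s).2 hs, ?_, ?_⟩
    · rw [UpperHalfPlane.vadd_re, h1, UpperHalfPlane.vadd_re]
    · simpa using h2

lemma sideLength_add_mul (P : PolygonalCusp p) (i k : ℤ) :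
    P.sideLength (i + k * p) = P.sideLength i := by
  have e : i + k * p + 1 = (i + 1) + k * p := by ring
  rw [sideLength, e, vertex_add_mul, vertex_add_mul,
    (UpperHalfPlane.isometry_real_vadd _).dist_eq, sideLength]

/-- Going down from a point of the region, one leaves it through a side. -/
lemma region_subset (P : PolygonalCusp p) : P.region ⊆ ⋃ i, aboveSet (P.side i) := by
  intro z hz
  obtain ⟨ε, hε, h⟩ := P.exists_im_lower_bound
  have hzε := h z hz
  have hw : (⟨⟨z.re, ε / 2⟩, half_pos hε⟩ : UpperHalfPlane) ∉ P.region := by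
    intro hw
    have h1 : ε ≤ ε / 2 := h _ hw
    linarith
  have hle : ε / 2 ≤ z.im := by linarith
  obtain ⟨s, hs, h1, -, h2⟩ := exists_mem_frontier_on_vertical (x := z.re) (half_pos hε)
    ⟨z, hz, rfl, hle, le_rfl⟩ ⟨_, hw, rfl, le_rfl, hle⟩
  rw [P.frontier_region] at hs
  obtain ⟨i, hi⟩ := Set.mem_iUnion.1 hs
  exact Set.mem_iUnion.2 ⟨i, s, hi, h1, h2⟩

lemma area_eq_volume_inter_unitStrip (P : PolygonalCusp p) :
    P.area = volume (P.region ∩ unitStrip 0) := by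
  simp [area, unitStrip]

/-- The area of a cusp is at most the area above its sides, counted with multiplicity. -/
lemma area_le_sum_volume_aboveSet (hp : 1 ≤ p) (P : PolygonalCusp p) :
    P.area ≤ ∑ i ∈ Finset.range p, volume (aboveSet (P.side (i : ℤ))) := by
  rw [area_eq_volume_inter_unitStrip,
    ← tsum_volume_inter_strip hp (fun i => aboveSet (P.side i)) P.vadd_mem_aboveSet_side_iff]
  refine le_trans (measure_mono ?_) (measure_iUnion_le _)
  rw [← Set.iUnion_inter]
  exact Set.inter_subset_inter_left _ P.region_subset

lemma exists_int_eq_nat_add_mul (hp : 1 ≤ p) (i : ℤ) :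
    ∃ j ∈ Finset.range p, ∃ k : ℤ, i = (j : ℤ) + k * p := by
  have hp' : (0 : ℤ) < p := by exact_mod_cast hp
  have h0 := Int.emod_nonneg i hp'.ne'
  have h1 := Int.emod_lt_of_pos i hp'
  refine ⟨(i % p).toNat, Finset.mem_range.2 (by omega), i / p, ?_⟩
  rw [Int.toNat_of_nonneg h0]
  have := Int.emod_add_mul_ediv i p
  linarith

/-- The isoperimetric inequality, with its case of equality. -/
lemma area_le_maxAreaAbove (hp : 1 ≤ p) (P : PolygonalCusp p) :
    P.area ≤ ENNReal.ofReal (p * maxAreaAbove (P.perimeter / p)) ∧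
      (P.area = ENNReal.ofReal (p * maxAreaAbove (P.perimeter / p)) →
        (∀ i, (P.vertex i).im = (P.vertex (i + 1)).im) ∧
          ∀ i j, P.sideLength i = P.sideLength j) := by
  have hp0 : (0 : ℝ) < p := by exact_mod_cast hp
  choose a ha0 hav hale haeq using fun i : ℤ => exists_volume_aboveSet (P.vertex_ne i)
  have hsum : P.area ≤ ENNReal.ofReal (∑ i ∈ Finset.range p, a (i : ℤ)) := by
    rw [ENNReal.ofReal_sum_of_nonneg fun i _ => ha0 _]
    refine (P.area_le_sum_volume_aboveSet hp).trans (le_of_eq (Finset.sum_congr rfl fun i _ => ?_))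
    exact hav i
  have h1 : ∑ i ∈ Finset.range p, a (i : ℤ) ≤
      ∑ i ∈ Finset.range p, maxAreaAbove (P.sideLength (i : ℤ)) :=
    Finset.sum_le_sum fun i _ => hale i
  have hw0 : ∀ i ∈ Finset.range p, (0 : ℝ) < 1 / p := fun _ _ => by positivity
  have hw1 : ∑ _i ∈ Finset.range p, (1 : ℝ) / p = 1 := by
    rw [Finset.sum_const, Finset.card_range, nsmul_eq_mul]
    field_simp
  have hmem : ∀ i ∈ Finset.range p, P.sideLength (i : ℤ) ∈ Set.Ici (0 : ℝ) :=
    fun i _ => dist_nonneg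
  have hmean : ∑ i ∈ Finset.range p, (1 / p : ℝ) • P.sideLength (i : ℤ) = P.perimeter / p := by
    rw [← Finset.smul_sum, perimeter, smul_eq_mul]; ring
  have hmeang : ∑ i ∈ Finset.range p, (1 / p : ℝ) • maxAreaAbove (P.sideLength (i : ℤ)) =
      (∑ i ∈ Finset.range p, maxAreaAbove (P.sideLength (i : ℤ))) / p := by
    rw [← Finset.smul_sum, smul_eq_mul]; ring
  have hjensen := strictConcaveOn_maxAreaAbove.concaveOn.le_map_sum
    (fun i hi => (hw0 i hi).le) hw1 hmem
  have hjeq := strictConcaveOn_maxAreaAbove.map_sum_eq_iff hw0 hw1 hmem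
  rw [hmean, hmeang] at hjensen hjeq
  rw [div_le_iff₀ hp0, mul_comm] at hjensen
  refine ⟨hsum.trans (ENNReal.ofReal_le_ofReal (h1.trans hjensen)), fun heq => ?_⟩
  rw [heq, ENNReal.ofReal_le_ofReal_iff (Finset.sum_nonneg fun i _ => ha0 _)] at hsum
  have h2 : ∑ i ∈ Finset.range p, a (i : ℤ) =
      ∑ i ∈ Finset.range p, maxAreaAbove (P.sideLength (i : ℤ)) := by linarith
  have h3 := (Finset.sum_eq_sum_iff_of_le fun (i : ℕ) _ => hale (i : ℤ)).1 h2
  have h4 := hjeq.1 (by rw [eq_div_iff hp0.ne']; linarith)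
  constructor
  · intro i
    obtain ⟨j, hj, k, rfl⟩ := exists_int_eq_nat_add_mul hp i
    have e : (j : ℤ) + k * p + 1 = ((j : ℤ) + 1) + k * p := by ring
    rw [e, vertex_add_mul, vertex_add_mul, UpperHalfPlane.vadd_im, UpperHalfPlane.vadd_im]
    exact haeq j (h3 j hj)
  · have h5 : ∀ i, P.sideLength i = P.perimeter / p := by
      intro i
      obtain ⟨j, hj, k, rfl⟩ := exists_int_eq_nat_add_mul hp i
      rw [sideLength_add_mul]
      exact h4 j hj
    intro i j
    rw [h5, h5]

/-- The vertices are the translates of one point by the multiples of `1 / p`. -/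
def IsUniform (P : PolygonalCusp p) : Prop :=
  ∀ i : ℤ, P.vertex i = (i / p : ℝ) +ᵥ P.vertex 0

lemma isUniform_of_translation (hp : 1 ≤ p) (P : PolygonalCusp p) (δ : ℝ)
    (h : ∀ i, P.vertex (i + 1) = δ +ᵥ P.vertex i) : P.IsUniform := by
  have hp0 : (0 : ℝ) < p := by exact_mod_cast hp
  have h1 : ∀ i : ℤ, P.vertex i = (i * δ : ℝ) +ᵥ P.vertex 0 := by
    intro i
    induction i using Int.induction_on with
    | zero => simp
    | succ k ih =>
      rw [h, ih, vadd_vadd]; push_cast; congr 1; ring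
    | pred k ih =>
      have h2 := h (-(k : ℤ) - 1)
      rw [sub_add_cancel, ih] at h2
      have h' := congrArg (fun z : UpperHalfPlane => (-δ) +ᵥ z) h2
      simp only [vadd_vadd] at h'
      rw [neg_add_cancel, zero_vadd] at h'
      rw [← h']; push_cast; congr 1; ring
  have h2 := P.vertex_add 0
  rw [zero_add, h1, UpperHalfPlane.vadd_right_cancel_iff] at h2
  have h3 : δ = 1 / p := by
    rw [eq_div_iff hp0.ne', mul_comm]; exact_mod_cast h2
  intro i
  rw [h1, h3, mul_one_div]

/-- If all vertices have the same height and all sides the same length, then the real part changes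
by a constant up to sign from one vertex to the next. The sign cannot change, because two
consecutive sides have only one point in common. -/
lemma isUniform_of_im_eq (hp : 1 ≤ p) (P : PolygonalCusp p)
    (him : ∀ i, (P.vertex i).im = (P.vertex (i + 1)).im)
    (hlen : ∀ i j, P.sideLength i = P.sideLength j) : P.IsUniform := by
  have hstep : ∀ i, (P.vertex (i + 1 + 1)).re - (P.vertex (i + 1)).re =
      (P.vertex (i + 1)).re - (P.vertex i).re := by
    intro i
    have h1 := congrArg Real.cosh (hlen i (i + 1))
    have hpos := (P.vertex i).im_pos
    simp only [sideLength, UpperHalfPlane.cosh_dist', ← him] at h1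
    rw [div_left_inj' (by positivity)] at h1
    have h2 : ((P.vertex (i + 1 + 1)).re - (P.vertex (i + 1)).re) ^ 2 =
      ((P.vertex (i + 1)).re - (P.vertex i).re) ^ 2 := by linarith
    rcases sq_eq_sq_iff_eq_or_eq_neg.1 h2 with h3 | h3
    · exact h3
    · exfalso
      have h4 : P.vertex (i + 1 + 1) = P.vertex i :=
        UpperHalfPlane.ext_re_im (by linarith) (by rw [← him, ← him])
      have h5 : P.vertex i ∈ geodesicSegment (P.vertex i) (P.vertex (i + 1)) ∩
          geodesicSegment (P.vertex (i + 1)) (P.vertex (i + 2)) := by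
        refine ⟨left_mem_geodesicSegment _ _, ?_⟩
        rw [show i + 2 = i + 1 + 1 by ring, h4]
        exact right_mem_geodesicSegment _ _
      rw [P.side_inter_side] at h5
      exact P.vertex_ne i h5
  have hconst : ∀ i, (P.vertex (i + 1)).re - (P.vertex i).re =
      (P.vertex (0 + 1)).re - (P.vertex 0).re := by
    intro i
    induction i using Int.induction_on with
    | zero => rfl
    | succ k ih => rw [hstep, ih]
    | pred k ih =>
      have h2 := hstep (-(k : ℤ) - 1)
      rw [sub_add_cancel, ih] at h2
      rw [sub_add_cancel]
      exact h2.symm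
  refine P.isUniform_of_translation hp ((P.vertex (0 + 1)).re - (P.vertex 0).re) fun i => ?_
  refine UpperHalfPlane.ext_re_im ?_ ?_
  · rw [UpperHalfPlane.vadd_re, ← hconst i]; ring
  · rw [UpperHalfPlane.vadd_im, ← him]

namespace IsUniform

variable {P : PolygonalCusp p}

lemma vertex_add (hP : P.IsUniform) (i j : ℤ) :
    P.vertex (i + j) = (i / p : ℝ) +ᵥ P.vertex j := by
  rw [hP (i + j), hP j, vadd_vadd]; push_cast; congr 1; ring

lemma sideLength_eq (hP : P.IsUniform) (i : ℤ) : P.sideLength i = P.sideLength 0 := by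
  have h := hP.vertex_add i 0
  rw [add_zero] at h
  rw [sideLength, hP.vertex_add i 1, h, (UpperHalfPlane.isometry_real_vadd _).dist_eq, sideLength,
    zero_add]

lemma isRegular (hP : P.IsUniform) : P.IsRegular := by
  constructor
  · intro i j
    rw [hP.sideLength_eq i, hP.sideLength_eq j]
  · have h : ∀ i, P.interiorAngle i = P.interiorAngle 0 := by
      intro i
      have h := hP.vertex_add i 0
      rw [add_zero] at h
      rw [interiorAngle, sub_eq_add_neg, hP.vertex_add i 1, hP.vertex_add i (-1), h,
        geodesicDirection_vadd, geodesicDirection_vadd, interiorAngle, zero_add, zero_sub]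
    intro i j
    rw [h i, h j]

lemma re_vertex_lt (hp : 1 ≤ p) (hP : P.IsUniform) (i : ℤ) :
    (P.vertex i).re < (P.vertex (i + 1)).re := by
  have hp0 : (0 : ℝ) < p := by exact_mod_cast hp
  rw [add_comm i, hP.vertex_add 1 i, UpperHalfPlane.vadd_re]
  have : (0 : ℝ) < ((1 : ℤ) : ℝ) / p := by push_cast; positivity
  linarith

lemma perimeter_eq (hP : P.IsUniform) : P.perimeter = p * P.sideLength 0 := by
  rw [perimeter, Finset.sum_congr rfl fun (i : ℕ) _ => hP.sideLength_eq i, Finset.sum_const,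
    Finset.card_range, nsmul_eq_mul]

lemma re_vertex_le (hp : 1 ≤ p) (hP : P.IsUniform) {i j : ℤ} (hij : i < j) :
    (P.vertex (i + 1)).re ≤ (P.vertex j).re := by
  have hp0 : (0 : ℝ) < p := by exact_mod_cast hp
  rw [hP (i + 1), hP j, UpperHalfPlane.vadd_re, UpperHalfPlane.vadd_re]
  have : (((i + 1 : ℤ) : ℝ)) ≤ j := by exact_mod_cast hij
  have := div_le_div_of_nonneg_right this hp0.le
  linarith

lemma eq_vertex_of_mem_side (hp : 1 ≤ p) (hP : P.IsUniform) {i : ℤ} {x : UpperHalfPlane}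
    (hx : x ∈ P.side i) :
    (P.vertex i).re ≤ x.re ∧ x.re ≤ (P.vertex (i + 1)).re ∧
      (x.re = (P.vertex i).re → x = P.vertex i) ∧
      (x.re = (P.vertex (i + 1)).re → x = P.vertex (i + 1)) := by
  have hlt := hP.re_vertex_lt hp i
  obtain ⟨c, r, -, hz, hw⟩ := exists_center hlt.ne
  obtain ⟨h1, h2, h3⟩ := (mem_geodesicSegment_iff_of_circle hlt hz hw).1 hx
  refine ⟨h2, h3, fun h => ?_, fun h => ?_⟩
  · refine UpperHalfPlane.ext_re_im h ((sq_eq_sq₀ x.im_pos.le (P.vertex i).im_pos.le).1 ?_)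
    rw [h] at h1; linarith
  · refine UpperHalfPlane.ext_re_im h ((sq_eq_sq₀ x.im_pos.le (P.vertex (i + 1)).im_pos.le).1 ?_)
    rw [h] at h1; linarith

lemma im_eq_of_mem_side_of_lt (hp : 1 ≤ p) (hP : P.IsUniform) {i j : ℤ} (hij : i < j)
    {x y : UpperHalfPlane} (hx : x ∈ P.side i) (hy : y ∈ P.side j) (h : x.re = y.re) :
    x.im = y.im := by
  obtain ⟨-, h2, -, h4⟩ := hP.eq_vertex_of_mem_side hp hx
  obtain ⟨h1, -, h3, -⟩ := hP.eq_vertex_of_mem_side hp hy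
  have h5 := hP.re_vertex_le hp hij
  rw [h4 (by linarith), h3 (by linarith), hP, hP j, UpperHalfPlane.vadd_im, UpperHalfPlane.vadd_im]

/-- The boundary curve is a graph. -/
lemma im_eq_of_mem_side (hp : 1 ≤ p) (hP : P.IsUniform) {i j : ℤ}
    {x y : UpperHalfPlane} (hx : x ∈ P.side i) (hy : y ∈ P.side j) (h : x.re = y.re) :
    x.im = y.im := by
  rcases lt_trichotomy i j with hij | rfl | hij
  · exact hP.im_eq_of_mem_side_of_lt hp hij hx hy h
  · have hlt := hP.re_vertex_lt hp i
    obtain ⟨c, r, -, hz, hw⟩ := exists_center hlt.ne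
    have h1 := ((mem_geodesicSegment_iff_of_circle hlt hz hw).1 hx).1
    have h2 := ((mem_geodesicSegment_iff_of_circle hlt hz hw).1 hy).1
    refine (sq_eq_sq₀ x.im_pos.le y.im_pos.le).1 ?_
    rw [h] at h1; linarith
  · exact (hP.im_eq_of_mem_side_of_lt hp hij hy hx h.symm).symm

/-- Going up from a point above the curve, one does not meet the curve again before reaching the
horoball. -/
lemma aboveSet_subset_region (hp : 1 ≤ p) (hP : P.IsUniform) (i : ℤ) :
    aboveSet (P.side i) ⊆ P.region := by
  rintro z ⟨s, hs, h1, h2⟩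
  by_contra hz
  obtain ⟨M, hM⟩ := P.exists_horoball
  have hle : z.im ≤ max z.im M := le_max_left _ _
  obtain ⟨x, hx, h3, h4, -⟩ := exists_mem_frontier_on_vertical (A := P.region) (x := z.re) z.im_pos
    ⟨⟨⟨z.re, max z.im M⟩, z.im_pos.trans_le hle⟩, hM _ (le_max_right _ _), rfl, hle, le_rfl⟩
    ⟨z, hz, rfl, le_rfl, hle⟩
  have hx' := hx
  rw [P.frontier_region] at hx'
  obtain ⟨j, hj⟩ := Set.mem_iUnion.1 hx'
  have h5 := hP.im_eq_of_mem_side hp hs hj (h1.trans h3.symm)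
  have h6 : x = z := UpperHalfPlane.ext_re_im h3 (by linarith)
  exact hz (P.isClosed_region.frontier_subset (h6 ▸ hx))

/-- The isoperimetric inequality is an equality for equally spaced vertices: the parts of the plane
above distinct sides overlap in null sets only. -/
lemma area_eq (hp : 1 ≤ p) (hP : P.IsUniform) :
    P.area = ENNReal.ofReal (p * maxAreaAbove (P.perimeter / p)) := by
  have hp0 : (0 : ℝ) < p := by exact_mod_cast hp
  refine le_antisymm (P.area_le_maxAreaAbove hp).1 ?_
  have hvol : ∀ i, volume (aboveSet (P.side i)) =
      ENNReal.ofReal (maxAreaAbove (P.perimeter / p)) := by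
    intro i
    obtain ⟨a, -, h1, -, h2⟩ := exists_volume_aboveSet_of_re_lt (hP.re_vertex_lt hp i)
    rw [side, h1, h2.2, hP.perimeter_eq, mul_div_cancel_left₀ _ hp0.ne', ← hP.sideLength_eq i,
      sideLength]
    rw [hP i, hP (i + 1), UpperHalfPlane.vadd_im, UpperHalfPlane.vadd_im]
  have hdisj : Pairwise (Function.onFun (AEDisjoint volume)
      fun i => aboveSet (P.side i) ∩ unitStrip 0) := by
    have key : ∀ i j : ℤ, i < j → AEDisjoint volume (aboveSet (P.side i) ∩ unitStrip 0)
        (aboveSet (P.side j) ∩ unitStrip 0) := by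
      intro i j hij
      refine measure_mono_null ?_ (volume_verticalLine (P.vertex j).re)
      rintro q ⟨⟨h1, -⟩, ⟨h2, -⟩⟩
      have h3 := (re_mem_Icc_of_mem_aboveSet (hP.re_vertex_lt hp i) h1).2
      have h4 := (re_mem_Icc_of_mem_aboveSet (hP.re_vertex_lt hp j) h2).1
      exact le_antisymm (h3.trans (hP.re_vertex_le hp hij)) h4
    intro i j hij
    rcases lt_or_gt_of_ne hij with h | h
    · exact key i j h
    · exact (key j i h).symm
  have hsum := tsum_volume_inter_strip hp (fun i => aboveSet (P.side i))
    P.vadd_mem_aboveSet_side_iff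
  rw [← measure_iUnion₀ hdisj fun i =>
    ((measurableSet_aboveSet (hP.re_vertex_lt hp i)).inter
      (measurableSet_unitStrip 0)).nullMeasurableSet] at hsum
  have h1 : ENNReal.ofReal (p * maxAreaAbove (P.perimeter / p)) =
      ∑ i ∈ Finset.range p, volume (aboveSet (P.side (i : ℤ))) := by
    rw [Finset.sum_congr rfl fun (i : ℕ) _ => hvol i, Finset.sum_const, Finset.card_range,
      nsmul_eq_mul, ENNReal.ofReal_mul hp0.le, ENNReal.ofReal_natCast]
  rw [h1, ← hsum, area_eq_volume_inter_unitStrip]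
  refine measure_mono (Set.iUnion_subset fun i => ?_)
  exact Set.inter_subset_inter_left _ (hP.aboveSet_subset_region hp i)

end IsUniform

end PolygonalCusp

/-! ### Möbius transformations and rigidity of regular cusps -/

lemma coe_sub_conj_ne_zero (z w : UpperHalfPlane) :
    (w : ℂ) - (starRingEnd ℂ) (z : ℂ) ≠ 0 := by
  intro h
  have h1 := congrArg Complex.im h
  simp only [Complex.sub_im, Complex.conj_im, Complex.zero_im] at h1
  have := z.im_pos
  have := w.im_pos
  change w.im - -z.im = 0 at h1
  linarith

lemma norm_geodesicDirection (z w : UpperHalfPlane) :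
    ‖geodesicDirection z w‖ = Real.tanh (dist z w / 2) := by
  rw [dist_comm, UpperHalfPlane.tanh_half_dist, geodesicDirection, norm_mul, Complex.norm_I,
    one_mul, norm_div, dist_eq_norm, dist_eq_norm]

lemma geodesicDirection_injective (z : UpperHalfPlane) :
    Function.Injective (geodesicDirection z) := by
  intro w w' h
  have h1 := mul_left_cancel₀ Complex.I_ne_zero h
  rw [div_eq_div_iff (coe_sub_conj_ne_zero z w) (coe_sub_conj_ne_zero z w')] at h1
  have h2 : ((w : ℂ) - w') * ((z : ℂ) - (starRingEnd ℂ) (z : ℂ)) = 0 := by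
    linear_combination h1
  rcases mul_eq_zero.1 h2 with h3 | h3
  · exact UpperHalfPlane.ext (sub_eq_zero.1 h3)
  · exact absurd h3 (coe_sub_conj_ne_zero z z)

lemma coe_sl_smul (g : Matrix.SpecialLinearGroup (Fin 2) ℝ) (z : UpperHalfPlane) :
    ((g • z : UpperHalfPlane) : ℂ) =
      ((g 0 0 : ℝ) * (z : ℂ) + (g 0 1 : ℝ)) / ((g 1 0 : ℝ) * (z : ℂ) + (g 1 1 : ℝ)) :=
  UpperHalfPlane.coe_specialLinearGroup_apply g z

lemma sl_det_eq (g : Matrix.SpecialLinearGroup (Fin 2) ℝ) :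
    g 0 0 * g 1 1 - g 0 1 * g 1 0 = 1 := by
  have := g.det_coe
  rwa [Matrix.det_fin_two] at this

lemma sl_denom_ne_zero (g : Matrix.SpecialLinearGroup (Fin 2) ℝ) {z : ℂ} (hz : z.im ≠ 0) :
    ((g 1 0 : ℝ) : ℂ) * z + (g 1 1 : ℝ) ≠ 0 := by
  intro h
  have hdet := sl_det_eq g
  have h1 := congrArg Complex.im h
  have h2 := congrArg Complex.re h
  simp at h1 h2
  rcases h1 with h1 | h1
  · rw [h1] at h2 hdet
    have h3 : g 1 1 = 0 := by simpa using h2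
    rw [h3] at hdet
    simp at hdet
  · exact hz h1

/-- The factor by which a Möbius transformation rotates directions at `z`. -/
noncomputable def rotationFactor (g : Matrix.SpecialLinearGroup (Fin 2) ℝ) (z : UpperHalfPlane) :
    ℂ :=
  ((g 1 0 : ℝ) * (starRingEnd ℂ) (z : ℂ) + (g 1 1 : ℝ)) / ((g 1 0 : ℝ) * (z : ℂ) + (g 1 1 : ℝ))

lemma geodesicDirection_smul (g : Matrix.SpecialLinearGroup (Fin 2) ℝ) (z w : UpperHalfPlane) :
    geodesicDirection (g • z) (g • w) = rotationFactor g z * geodesicDirection z w := by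
  have hdet : ((g 0 0 : ℝ) : ℂ) * (g 1 1 : ℝ) - (g 0 1 : ℝ) * (g 1 0 : ℝ) = 1 := by
    exact_mod_cast sl_det_eq g
  have hz := sl_denom_ne_zero g (z := (z : ℂ)) z.im_pos.ne'
  have hw := sl_denom_ne_zero g (z := (w : ℂ)) w.im_pos.ne'
  have hz' := sl_denom_ne_zero g (z := (starRingEnd ℂ) (z : ℂ))
    (by rw [Complex.conj_im]; exact neg_ne_zero.2 z.im_pos.ne')
  rw [geodesicDirection, geodesicDirection, rotationFactor]
  have e1 : ((g • w : UpperHalfPlane) : ℂ) - ((g • z : UpperHalfPlane) : ℂ) =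
      ((w : ℂ) - z) / ((((g 1 0 : ℝ) : ℂ) * (w : ℂ) + (g 1 1 : ℝ)) *
        (((g 1 0 : ℝ) : ℂ) * (z : ℂ) + (g 1 1 : ℝ))) := by
    rw [coe_sl_smul, coe_sl_smul, div_sub_div _ _ hw hz]
    congr 1
    linear_combination ((w : ℂ) - z) * hdet
  have e2 : ((g • w : UpperHalfPlane) : ℂ) - (starRingEnd ℂ) ((g • z : UpperHalfPlane) : ℂ) =
      ((w : ℂ) - (starRingEnd ℂ) (z : ℂ)) / ((((g 1 0 : ℝ) : ℂ) * (w : ℂ) + (g 1 1 : ℝ)) *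
        (((g 1 0 : ℝ) : ℂ) * (starRingEnd ℂ) (z : ℂ) + (g 1 1 : ℝ))) := by
    rw [coe_sl_smul, coe_sl_smul, map_div₀, map_add, map_add, map_mul, map_mul,
      Complex.conj_ofReal, Complex.conj_ofReal, Complex.conj_ofReal, Complex.conj_ofReal,
      div_sub_div _ _ hw hz']
    congr 1
    linear_combination ((w : ℂ) - (starRingEnd ℂ) (z : ℂ)) * hdet
  rw [e1, e2]
  generalize ((g 1 0 : ℝ) : ℂ) * (w : ℂ) + (g 1 1 : ℝ) = dw at hw
  generalize ((g 1 0 : ℝ) : ℂ) * (z : ℂ) + (g 1 1 : ℝ) = dz at hz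
  field_simp

/-- The stabilizer of `I` acts transitively on the circles centred at `I`: the rotation by the angle
`t` in `SL(2, ℝ)` turns directions at `I` by the angle `2 * t`. -/
lemma exists_rotation {a b : UpperHalfPlane}
    (h : dist UpperHalfPlane.I a = dist UpperHalfPlane.I b) :
    ∃ k : Matrix.SpecialLinearGroup (Fin 2) ℝ, k • UpperHalfPlane.I = UpperHalfPlane.I ∧
      k • a = b := by
  set t : ℝ := Complex.arg (geodesicDirection UpperHalfPlane.I b /
    geodesicDirection UpperHalfPlane.I a) / 2 with ht
  let k : Matrix.SpecialLinearGroup (Fin 2) ℝ :=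
    ⟨!![Real.cos t, Real.sin t; -Real.sin t, Real.cos t], by
      rw [Matrix.det_fin_two_of]; linarith [Real.cos_sq_add_sin_sq t]⟩
  have k00 : k 0 0 = Real.cos t := rfl
  have k01 : k 0 1 = Real.sin t := rfl
  have k10 : k 1 0 = -Real.sin t := rfl
  have k11 : k 1 1 = Real.cos t := rfl
  have hden := sl_denom_ne_zero k (z := (UpperHalfPlane.I : ℂ)) (by simp)
  rw [k10, k11] at hden
  have hfix : k • UpperHalfPlane.I = UpperHalfPlane.I := by
    apply UpperHalfPlane.ext
    rw [coe_sl_smul, k00, k01, k10, k11, div_eq_iff hden, UpperHalfPlane.coe_I]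
    push_cast
    linear_combination Complex.sin t * Complex.I_sq
  refine ⟨k, hfix, geodesicDirection_injective UpperHalfPlane.I ?_⟩
  have hdir := geodesicDirection_smul k UpperHalfPlane.I a
  rw [hfix] at hdir
  rw [hdir]
  have hnorm : ‖geodesicDirection UpperHalfPlane.I a‖ = ‖geodesicDirection UpperHalfPlane.I b‖ := by
    rw [norm_geodesicDirection, norm_geodesicDirection, h]
  by_cases h0 : geodesicDirection UpperHalfPlane.I a = 0
  · rw [h0, norm_zero] at hnorm
    rw [h0, mul_zero, norm_eq_zero.1 hnorm.symm]
  · have hfac : rotationFactor k UpperHalfPlane.I = Complex.exp ((2 * t : ℝ) * Complex.I) := by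
      rw [rotationFactor, k10, k11, div_eq_iff hden, UpperHalfPlane.coe_I, Complex.conj_I,
        Complex.exp_mul_I]
      push_cast
      rw [Complex.cos_two_mul, Complex.sin_two_mul]
      have h1 := Complex.sin_sq_add_cos_sq (t : ℂ)
      linear_combination (2 * Complex.sin t ^ 2 * Complex.cos t) * Complex.I_sq -
        2 * Complex.cos t * h1
    have hq : ‖geodesicDirection UpperHalfPlane.I b /
        geodesicDirection UpperHalfPlane.I a‖ = 1 := by
      rw [norm_div, hnorm, div_self]
      rw [← hnorm]; exact norm_ne_zero_iff.2 h0
    have h2 := Complex.norm_mul_exp_arg_mul_I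
      (geodesicDirection UpperHalfPlane.I b / geodesicDirection UpperHalfPlane.I a)
    rw [hq, Complex.ofReal_one, one_mul] at h2
    rw [hfac, ht, mul_div_cancel₀ _ two_ne_zero, h2, div_mul_cancel₀ _ h0]

/-- The group `SL(2, ℝ)` acts transitively on pairs of points at a given distance. -/
lemma exists_smul_eq_of_dist_eq {z w z' w' : UpperHalfPlane} (h : dist z w = dist z' w') :
    ∃ g : Matrix.SpecialLinearGroup (Fin 2) ℝ, g • z = z' ∧ g • w = w' := by
  have e : ∀ z w : UpperHalfPlane,
      dist UpperHalfPlane.I (z.toSL2R⁻¹ • w) = dist z w := by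
    intro z w
    rw [← dist_smul z.toSL2R UpperHalfPlane.I, UpperHalfPlane.toSL2R_smul_I, smul_inv_smul]
  obtain ⟨k, hk1, hk2⟩ := exists_rotation (a := z.toSL2R⁻¹ • w) (b := z'.toSL2R⁻¹ • w')
    (by rw [e, e, h])
  refine ⟨z'.toSL2R * k * z.toSL2R⁻¹, ?_, ?_⟩
  · have : z.toSL2R⁻¹ • z = UpperHalfPlane.I := by
      rw [inv_smul_eq_iff, UpperHalfPlane.toSL2R_smul_I]
    rw [mul_smul, mul_smul, this, hk1, UpperHalfPlane.toSL2R_smul_I]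
  · rw [mul_smul, mul_smul, hk2, smul_inv_smul]

/-- A Möbius transformation commuting with the unit translation at one point is a translation.
Indeed, if `c` and `d` are the lower entries of its matrix, then `u = c * z + d` satisfies
`u ^ 2 + c * u = 1`. This real quadratic equation has positive discriminant, so `u` is real, and
therefore `c = 0`. -/
lemma exists_translation_of_commute (g : Matrix.SpecialLinearGroup (Fin 2) ℝ) (z : UpperHalfPlane)
    (h : g • ((1 : ℝ) +ᵥ z) = (1 : ℝ) +ᵥ (g • z)) :
    ∃ δ : ℝ, ∀ w : UpperHalfPlane, g • w = δ +ᵥ w := by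
  have hdet := sl_det_eq g
  have hdet' : ((g 0 0 : ℝ) : ℂ) * (g 1 1 : ℝ) - (g 0 1 : ℝ) * (g 1 0 : ℝ) = 1 := by
    exact_mod_cast hdet
  have hz := sl_denom_ne_zero g (z := (z : ℂ)) z.im_pos.ne'
  have hz1 := sl_denom_ne_zero g (z := (((1 : ℝ) +ᵥ z : UpperHalfPlane) : ℂ))
    ((1 : ℝ) +ᵥ z).im_pos.ne'
  have h1 := congrArg UpperHalfPlane.coe h
  rw [coe_sl_smul, UpperHalfPlane.coe_vadd 1 (g • z), coe_sl_smul] at h1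
  rw [UpperHalfPlane.coe_vadd] at hz1 h1
  push_cast at hz1 h1
  have h2 : (((g 1 0 : ℝ) : ℂ) * (z : ℂ) + (g 1 1 : ℝ)) ^ 2 +
      (g 1 0 : ℝ) * (((g 1 0 : ℝ) : ℂ) * (z : ℂ) + (g 1 1 : ℝ)) = 1 := by
    rw [div_eq_iff hz1] at h1
    have h3 := div_mul_cancel₀ (((g 0 0 : ℝ) : ℂ) * (z : ℂ) + (g 0 1 : ℝ)) hz
    linear_combination hdet' - (((g 1 0 : ℝ) : ℂ) * (z : ℂ) + (g 1 1 : ℝ)) * h1 -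
      (((g 1 0 : ℝ) : ℂ) * (1 + (z : ℂ)) + (g 1 1 : ℝ)) * h3
  have him := congrArg Complex.im h2
  have hre := congrArg Complex.re h2
  have hy := z.im_pos
  simp [pow_two] at him hre
  have hc : g 1 0 = 0 := by
    by_contra hc
    have h3 : g 1 0 * z.im ≠ 0 := mul_ne_zero hc hy.ne'
    have h4 : 2 * (g 1 0 * z.re + g 1 1) + g 1 0 = 0 := by
      apply mul_left_cancel₀ h3
      linear_combination him
    have h5 : g 1 0 * z.re + g 1 1 = -(g 1 0) / 2 := by linarith
    rw [h5] at hre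
    nlinarith [sq_nonneg (g 1 0), sq_nonneg (g 1 0 * z.im)]
  rw [hc] at hre hdet
  have hd : g 1 1 * g 1 1 = 1 := by simpa using hre
  have hd0 : g 1 1 ≠ 0 := by rintro h0; rw [h0] at hd; simp at hd
  have had : g 0 0 = g 1 1 := by
    apply mul_right_cancel₀ hd0; linarith
  refine ⟨g 0 1 * g 1 1, fun w => UpperHalfPlane.ext ?_⟩
  rw [coe_sl_smul, UpperHalfPlane.coe_vadd, hc, had]
  have hd' : ((g 1 1 : ℝ) : ℂ) * (g 1 1 : ℝ) = 1 := by exact_mod_cast hd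
  have hd0' : ((g 1 1 : ℝ) : ℂ) ≠ 0 := by exact_mod_cast hd0
  push_cast
  rw [zero_mul, zero_add, div_eq_iff hd0']
  linear_combination -((g 0 1 : ℝ) : ℂ) * hd'

namespace PolygonalCusp

variable {p : ℕ}

/-- The ratio of directions defining an interior angle has modulus one, as adjacent sides have the
same length, so it is determined by the angle. -/
lemma IsRegular.direction_ratio_eq {R : PolygonalCusp p} (hR : R.IsRegular) (i j : ℤ) :
    geodesicDirection (R.vertex i) (R.vertex (i - 1)) /
        geodesicDirection (R.vertex i) (R.vertex (i + 1)) =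
      geodesicDirection (R.vertex j) (R.vertex (j - 1)) /
        geodesicDirection (R.vertex j) (R.vertex (j + 1)) := by
  have hnorm : ∀ i, ‖geodesicDirection (R.vertex i) (R.vertex (i - 1)) /
      geodesicDirection (R.vertex i) (R.vertex (i + 1))‖ = 1 := by
    intro i
    have h1 := hR.1 (i - 1) i
    rw [sideLength, sideLength, sub_add_cancel, dist_comm] at h1
    rw [norm_div, norm_geodesicDirection, norm_geodesicDirection, h1, div_self]
    have h2 := dist_pos.2 (R.vertex_ne i)
    rw [Real.tanh_eq_sinh_div_cosh]
    exact div_ne_zero (Real.sinh_pos_iff.2 (by linarith)).ne' (Real.cosh_pos _).ne'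
  have hang := hR.2 j i
  rw [interiorAngle, interiorAngle, toIcoMod_eq_toIcoMod] at hang
  obtain ⟨n, hn⟩ := hang
  have hexp : ∀ q : ℂ, ‖q‖ = 1 → q = Complex.exp (q.arg * Complex.I) := by
    intro q hq
    have := Complex.norm_mul_exp_arg_mul_I q
    rw [hq, Complex.ofReal_one, one_mul] at this
    exact this.symm
  rw [hexp _ (hnorm i), hexp _ (hnorm j), Complex.exp_eq_exp_iff_exists_int]
  refine ⟨n, ?_⟩
  have h1 := congrArg (fun x : ℝ => (x : ℂ)) hn
  simp only [zsmul_eq_mul] at h1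
  push_cast at h1
  linear_combination Complex.I * h1

/-- The Möbius transformation taking the first side to the second one shifts all vertices by one,
because each vertex is determined by the two preceding ones, the side length and the angle. -/
lemma IsRegular.isUniform (hp : 1 ≤ p) {R : PolygonalCusp p} (hR : R.IsRegular) :
    R.IsUniform := by
  obtain ⟨g, hg0, hg1⟩ := exists_smul_eq_of_dist_eq (hR.1 0 1)
  have hg : ∀ n : ℕ, g • R.vertex n = R.vertex (n + 1) ∧
      g • R.vertex (n + 1) = R.vertex (n + 1 + 1) := by
    intro n
    induction n with
    | zero => exact ⟨hg0, hg1⟩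
    | succ n ih =>
      push_cast
      refine ⟨ih.2, geodesicDirection_injective (R.vertex (n + 1 + 1)) ?_⟩
      have h1 := hR.direction_ratio_eq (n + 1 + 1) (n + 1)
      rw [add_sub_cancel_right, add_sub_cancel_right] at h1
      have hne : ∀ i, geodesicDirection (R.vertex i) (R.vertex (i + 1)) ≠ 0 := by
        intro i h0
        have h2 := R.vertex_ne i
        apply h2
        apply geodesicDirection_injective (R.vertex i)
        rw [h0]; simp [geodesicDirection]
      have hne' : geodesicDirection (R.vertex (n + 1)) (R.vertex n) ≠ 0 := by
        intro h0
        apply R.vertex_ne n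
        apply geodesicDirection_injective (R.vertex (n + 1))
        rw [h0]; simp [geodesicDirection]
      have h3 := geodesicDirection_smul g (R.vertex (n + 1)) (R.vertex n)
      have h4 := geodesicDirection_smul g (R.vertex (n + 1)) (R.vertex (n + 1 + 1))
      rw [ih.1, ih.2] at h3
      rw [ih.2] at h4
      rw [h4]
      rw [h3, div_eq_div_iff (hne _) (hne _)] at h1
      apply mul_left_cancel₀ hne'
      linear_combination h1
  -- Shifting the index by `p` is the unit translation.
  have hcomm : g • ((1 : ℝ) +ᵥ R.vertex 0) = (1 : ℝ) +ᵥ (g • R.vertex 0) := by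
    have h1 := (hg p).1
    have h2 := R.vertex_add 0
    have h3 := R.vertex_add 1
    rw [zero_add] at h2
    rw [h2, add_comm, h3] at h1
    rw [h1, hg0]
  obtain ⟨δ, hδ⟩ := exists_translation_of_commute g _ hcomm
  refine R.isUniform_of_translation hp δ fun i => ?_
  obtain ⟨j, -, k, rfl⟩ := exists_int_eq_nat_add_mul hp i
  have e : (j : ℤ) + k * p + 1 = ((j : ℤ) + 1) + k * p := by ring
  rw [e, vertex_add_mul, vertex_add_mul, ← (hg j).1, hδ, vadd_vadd, vadd_vadd, add_comm]

end PolygonalCusp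

/-! ### Existence of the regular cusp -/

namespace PolygonalCusp

variable {p : ℕ}

/-- The vertices of the regular cusp whose vertices lie at height `y`; the side number `i` is then
an arc of a circle with centre `i / p`. -/
noncomputable def uniformVertex (p : ℕ) {y : ℝ} (hy : 0 < y) (i : ℤ) : UpperHalfPlane :=
  ⟨⟨(i - 1 / 2) / p, y⟩, hy⟩

lemma mem_geodesicSegment_uniformVertex (hp : 1 ≤ p) {y : ℝ} (hy : 0 < y) {r : ℝ}
    (hr : r ^ 2 = (1 / (2 * p)) ^ 2 + y ^ 2) (i : ℤ) (x : UpperHalfPlane) :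
    x ∈ geodesicSegment (uniformVertex p hy i) (uniformVertex p hy (i + 1)) ↔
      (x.re - i / p) ^ 2 + x.im ^ 2 = r ^ 2 ∧ |x.re - i / p| ≤ 1 / (2 * p) := by
  have hp0 : (0 : ℝ) < p := by exact_mod_cast hp
  have e1 : (uniformVertex p hy i).re = i / p - 1 / (2 * p) := by
    change ((i : ℝ) - 1 / 2) / p = _
    field_simp
  have e2 : (uniformVertex p hy (i + 1)).re = i / p + 1 / (2 * p) := by
    change (((i + 1 : ℤ) : ℝ) - 1 / 2) / p = _
    push_cast
    field_simp
    ring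
  have e3 : ∀ i, (uniformVertex p hy i).im = y := fun _ => rfl
  have hpos : (0 : ℝ) < 1 / (2 * p) := by positivity
  rw [mem_geodesicSegment_iff_of_circle (c := i / p) (r := r) (by rw [e1, e2]; linarith)
    (by rw [e1, e3, hr]; ring) (by rw [e2, e3, hr]; ring), e1, e2, abs_le]
  refine and_congr_right fun _ => ?_
  constructor <;> rintro ⟨h1, h2⟩ <;> constructor <;> linarith

/-- Among the centres `j / p`, the nearest one is the one at distance at most `1 / (2 * p)`. -/
lemma sq_sub_div_le (hp : 1 ≤ p) {x : ℝ} {i : ℤ} (h : |x - i / p| ≤ 1 / (2 * p)) (j : ℤ) :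
    (x - i / p) ^ 2 ≤ (x - j / p) ^ 2 := by
  have hp0 : (0 : ℝ) < p := by exact_mod_cast hp
  rcases eq_or_ne i j with rfl | hij
  · exact le_rfl
  · refine sq_le_sq.2 (h.trans ?_)
    have h1 : (1 : ℝ) ≤ |(i : ℝ) - j| := by
      exact_mod_cast Int.one_le_abs (sub_ne_zero.2 hij)
    have h2 : |(i : ℝ) / p - j / p| = |(i : ℝ) - j| / p := by
      rw [← sub_div, abs_div, abs_of_pos hp0]
    have h3 : 1 / (p : ℝ) ≤ |(i : ℝ) / p - j / p| := by
      rw [h2]; exact div_le_div_of_nonneg_right h1 hp0.le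
    have h4 : |(i : ℝ) / p - j / p| ≤ |x - i / p| + |x - j / p| := by
      rw [abs_sub_comm x (i / p)]
      exact abs_sub_le _ _ _
    have h5 : 1 / (p : ℝ) = 1 / (2 * p) + 1 / (2 * p) := by field_simp; norm_num
    linarith

lemma abs_sub_round_div_le (hp : 1 ≤ p) (x : ℝ) :
    |x - (round (p * x) : ℤ) / p| ≤ 1 / (2 * p) := by
  have hp0 : (0 : ℝ) < p := by exact_mod_cast hp
  have h := abs_sub_round (p * x)
  have e : x - (round (p * x) : ℤ) / p = (p * x - (round (p * x) : ℤ)) / p := by field_simp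
  rw [e, abs_div, abs_of_pos hp0, div_le_iff₀ hp0]
  refine h.trans (le_of_eq ?_)
  field_simp

/-- The exterior of the circles of radius `r` with centres `i / p`. -/
def circlesExterior (p : ℕ) (r : ℝ) : Set UpperHalfPlane :=
  {z | ∀ i : ℤ, r ^ 2 ≤ (z.re - i / p) ^ 2 + z.im ^ 2}

lemma isClosed_circlesExterior (p : ℕ) (r : ℝ) : IsClosed (circlesExterior p r) := by
  have : circlesExterior p r = ⋂ i : ℤ, {z | r ^ 2 ≤ (z.re - i / p) ^ 2 + z.im ^ 2} := by
    ext z; simp [circlesExterior]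
  rw [this]
  refine isClosed_iInter fun i => isClosed_le continuous_const ?_
  exact ((UpperHalfPlane.continuous_re.sub continuous_const).pow 2).add
    (UpperHalfPlane.continuous_im.pow 2)

lemma frontier_circlesExterior (hp : 1 ≤ p) {r : ℝ} (hr : 0 < r) :
    frontier (circlesExterior p r) =
      ⋃ i : ℤ, {x : UpperHalfPlane |
        (x.re - i / p) ^ 2 + x.im ^ 2 = r ^ 2 ∧ |x.re - i / p| ≤ 1 / (2 * p)} := by
  rw [(isClosed_circlesExterior p r).frontier_eq]
  ext z
  rw [Set.mem_iUnion]
  constructor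
  · rintro ⟨h1, h2⟩
    have hround := abs_sub_round_div_le hp z.re
    set i := round (p * z.re) with hi
    refine ⟨i, ?_, hround⟩
    by_contra hne
    refine h2 ?_
    have hlt : r ^ 2 < (z.re - i / p) ^ 2 + z.im ^ 2 := lt_of_le_of_ne (h1 i) (Ne.symm hne)
    have hnorm : ∀ (w : UpperHalfPlane) (j : ℤ),
        dist (w : ℂ) ((j / p : ℝ) : ℂ) ^ 2 = (w.re - j / p) ^ 2 + w.im ^ 2 := by
      intro w j
      rw [dist_eq_norm, Complex.sq_norm, Complex.normSq_apply, Complex.sub_re, Complex.sub_im,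
        Complex.ofReal_re, Complex.ofReal_im, sub_zero]
      change (w.re - j / p) * (w.re - j / p) + w.im * w.im = _
      ring
    have hlt' : r < dist (z : ℂ) ((i / p : ℝ) : ℂ) :=
      lt_of_pow_lt_pow_left₀ 2 dist_nonneg (by rw [hnorm]; exact hlt)
    -- All centres are at distance at least `|z - i / p|`, which leaves room uniformly.
    refine mem_interior.2 ⟨{w | dist (w : ℂ) (z : ℂ) < dist (z : ℂ) ((i / p : ℝ) : ℂ) - r}, ?_, ?_,
      ?_⟩
    · intro w hw j
      have hw : dist (w : ℂ) (z : ℂ) < dist (z : ℂ) ((i / p : ℝ) : ℂ) - r := hw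
      have h3 : dist (z : ℂ) ((i / p : ℝ) : ℂ) ≤ dist (z : ℂ) ((j / p : ℝ) : ℂ) := by
        refine (sq_le_sq₀ dist_nonneg dist_nonneg).1 ?_
        rw [hnorm, hnorm]
        linarith [sq_sub_div_le hp hround j]
      have h4 := dist_triangle (z : ℂ) (w : ℂ) ((j / p : ℝ) : ℂ)
      rw [dist_comm (z : ℂ) (w : ℂ)] at h4
      rw [← hnorm]
      exact pow_le_pow_left₀ hr.le (by linarith) 2
    · exact isOpen_lt (UpperHalfPlane.continuous_coe.dist continuous_const) continuous_const
    · change dist (z : ℂ) (z : ℂ) < _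
      rw [dist_self]; linarith
  · rintro ⟨i, h1, h2⟩
    refine ⟨fun j => ?_, fun hint => ?_⟩
    · rw [← h1]
      linarith [sq_sub_div_le hp h2 j]
    · obtain ⟨δ, hδ, hball⟩ := Metric.isOpen_iff.1 isOpen_interior z hint
      have hpos : 0 < z.im * Real.exp (-(δ / 2)) := mul_pos z.im_pos (Real.exp_pos _)
      let w : UpperHalfPlane := ⟨⟨z.re, z.im * Real.exp (-(δ / 2))⟩, hpos⟩
      have hwre : w.re = z.re := rfl
      have hwim : w.im = z.im * Real.exp (-(δ / 2)) := rfl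
      have hw : w ∈ Metric.ball z δ := by
        rw [Metric.mem_ball, UpperHalfPlane.dist_of_re_eq hwre, hwim,
          Real.log_mul z.im_pos.ne' (Real.exp_pos _).ne', Real.log_exp, Real.dist_eq,
          add_sub_cancel_left, abs_neg, abs_of_pos (by linarith)]
        linarith
      have h3 := interior_subset (hball hw) i
      rw [hwre, hwim] at h3
      have h4 : z.im * Real.exp (-(δ / 2)) < z.im :=
        mul_lt_of_lt_one_right z.im_pos (Real.exp_lt_one_iff.2 (by linarith))
      have h5 := pow_lt_pow_left₀ h4 hpos.le two_ne_zero
      linarith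

/-- The regular `p`-sided cusp with vertices at height `y`. -/
noncomputable def uniform (hp : 1 ≤ p) {y : ℝ} (hy : 0 < y) : PolygonalCusp p :=
  have hp0 : (0 : ℝ) < p := by exact_mod_cast hp
  have hpos : 0 < (1 / (2 * p) : ℝ) ^ 2 + y ^ 2 := by positivity
  have hr : √((1 / (2 * p)) ^ 2 + y ^ 2) ^ 2 = (1 / (2 * p)) ^ 2 + y ^ 2 := Real.sq_sqrt hpos.le
  have hside := mem_geodesicSegment_uniformVertex hp hy hr
  { region := circlesExterior p √((1 / (2 * p)) ^ 2 + y ^ 2)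
    vertex := uniformVertex p hy
    isClosed_region := isClosed_circlesExterior _ _
    translate_mem_iff := by
      have e : ∀ (z : UpperHalfPlane) (i : ℤ),
          (((1 : ℝ) +ᵥ z).re - (i + p : ℤ) / p) ^ 2 + ((1 : ℝ) +ᵥ z).im ^ 2 =
            (z.re - i / p) ^ 2 + z.im ^ 2 := by
        intro z i
        rw [UpperHalfPlane.vadd_re, UpperHalfPlane.vadd_im]
        push_cast
        rw [add_div, div_self hp0.ne']
        ring
      intro z
      constructor
      · intro h i
        rw [← e]
        exact h _
      · intro h i
        have := h (i - p)
        rwa [← e, sub_add_cancel] at this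
    exists_horoball := by
      refine ⟨√((1 / (2 * p)) ^ 2 + y ^ 2), fun z hz i => ?_⟩
      have := pow_le_pow_left₀ (Real.sqrt_nonneg _) hz 2
      linarith [sq_nonneg (z.re - i / p)]
    exists_im_lower_bound := by
      refine ⟨y, hy, fun z hz => ?_⟩
      have h1 := hz (round (p * z.re))
      have h2 := sq_le_sq.2 ((abs_sub_round_div_le hp z.re).trans (le_abs_self _))
      rw [hr] at h1
      exact (sq_le_sq₀ hy.le z.im_pos.le).1 (by linarith)
    vertex_add := by
      intro i
      refine UpperHalfPlane.ext_re_im ?_ ?_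
      · rw [UpperHalfPlane.vadd_re]
        change (((i + p : ℤ) : ℝ) - 1 / 2) / p = 1 + (i - 1 / 2) / p
        push_cast
        field_simp
        ring
      · rw [UpperHalfPlane.vadd_im]
        rfl
    vertex_ne := by
      intro i h
      have h1 : ((i : ℝ) - 1 / 2) / p = (((i + 1 : ℤ) : ℝ) - 1 / 2) / p :=
        congrArg UpperHalfPlane.re h
      rw [div_left_inj' hp0.ne'] at h1
      push_cast at h1
      linarith
    side_inter_side := by
      intro i
      refine Set.Subset.antisymm ?_ ?_
      · rintro x ⟨h1, h2⟩
        rw [show i + 2 = i + 1 + 1 by ring] at h2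
        obtain ⟨h3, h4⟩ := (hside i x).1 h1
        obtain ⟨h5, h6⟩ := (hside (i + 1) x).1 h2
        rw [abs_le] at h4 h6
        have e1 : (((i + 1 : ℤ) : ℝ)) / p = i / p + 2 * (1 / (2 * p)) := by
          push_cast; field_simp
        have hre : x.re = i / p + 1 / (2 * p) := by
          rw [e1] at h6; linarith [h4.2, h6.1]
        refine UpperHalfPlane.ext_re_im ?_ ?_
        · change x.re = (((i + 1 : ℤ) : ℝ) - 1 / 2) / p
          rw [hre]; push_cast; field_simp; ring
        · change x.im = y
          rw [hre, hr] at h3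
          refine (sq_eq_sq₀ x.im_pos.le hy.le).1 (by linarith)
      · rintro x rfl
        exact ⟨right_mem_geodesicSegment _ _, left_mem_geodesicSegment _ _⟩
    side_disjoint := by
      intro i j hij
      refine Set.disjoint_left.2 fun x h1 h2 => ?_
      have h3 := (abs_le.1 ((hside i x).1 h1).2).2
      have h4 := (abs_le.1 ((hside j x).1 h2).2).1
      have h5 : ((i : ℝ) + 1) / p < j / p :=
        div_lt_div_of_pos_right (by exact_mod_cast hij) hp0
      have h6 : ((i : ℝ) + 1) / p = i / p + 2 * (1 / (2 * p)) := by field_simp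
      linarith
    frontier_region := by
      rw [frontier_circlesExterior hp (Real.sqrt_pos.2 hpos)]
      refine Set.iUnion_congr fun i => ?_
      ext x
      exact (hside i x).symm }

lemma isUniform_uniform (hp : 1 ≤ p) {y : ℝ} (hy : 0 < y) : (uniform hp hy).IsUniform := by
  intro i
  refine UpperHalfPlane.ext_re_im ?_ ?_
  · rw [UpperHalfPlane.vadd_re]
    change ((i : ℝ) - 1 / 2) / p = i / p + (((0 : ℤ) : ℝ) - 1 / 2) / p
    push_cast
    ring
  · rw [UpperHalfPlane.vadd_im]
    rfl

lemma sinh_half_sideLength_uniform (hp : 1 ≤ p) {y : ℝ} (hy : 0 < y) :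
    Real.sinh ((uniform hp hy).sideLength 0 / 2) = 1 / (2 * p * y) := by
  have hp0 : (0 : ℝ) < p := by exact_mod_cast hp
  have h1 : ((uniform hp hy).vertex (0 + 1) : ℂ) = (1 / p : ℝ) + (uniform hp hy).vertex 0 := by
    rw [isUniform_uniform hp hy (0 + 1), UpperHalfPlane.coe_vadd]
    push_cast
    simp
  have him : ∀ i, ((uniform hp hy).vertex i).im = y := fun _ => rfl
  rw [sideLength, UpperHalfPlane.sinh_half_dist, him, him, Real.sqrt_mul_self hy.le, h1,
    dist_comm, dist_eq_norm, add_sub_cancel_right, Complex.norm_real, Real.norm_eq_abs,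
    abs_of_pos (by positivity)]
  field_simp

lemma exists_isUniform_area_eq (hp : 1 ≤ p) {A : ℝ} (h0 : 0 < A) (h1 : A < p * Real.pi) :
    ∃ R : PolygonalCusp p, R.IsUniform ∧ R.area = ENNReal.ofReal A := by
  have hp0 : (0 : ℝ) < p := by exact_mod_cast hp
  have h2 : 0 < A / (2 * p) := by positivity
  have h3 : A / (2 * p) < Real.pi / 2 := by
    rw [div_lt_div_iff₀ (by positivity) two_pos]; linarith
  have htan := Real.tan_pos_of_pos_of_lt_pi_div_two h2 h3
  have hy : 0 < 1 / (2 * p * Real.tan (A / (2 * p))) := by positivity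
  refine ⟨uniform hp hy, isUniform_uniform hp hy, ?_⟩
  have hU := isUniform_uniform hp hy
  rw [hU.area_eq hp, hU.perimeter_eq, mul_div_cancel_left₀ _ hp0.ne', maxAreaAbove,
    sinh_half_sideLength_uniform]
  have e : 1 / (2 * p * (1 / (2 * p * Real.tan (A / (2 * p))))) = Real.tan (A / (2 * p)) := by
    field_simp
  rw [e, Real.arctan_tan (by linarith [Real.pi_pos]) h3]
  congr 1
  field_simp

lemma area_pos (P : PolygonalCusp p) : 0 < P.area := by
  obtain ⟨M, hM⟩ := P.exists_horoball
  have hM1 : 0 < max M 1 := lt_max_of_lt_right one_pos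
  have h1 := volume_above_graph (I := Set.Ico (0 : ℝ) 1) measurableSet_Ico
    (f := fun _ => max M 1) measurable_const (fun _ _ => hM1)
  rw [setLIntegral_const, Real.volume_Ico, sub_zero, ENNReal.ofReal_one, mul_one] at h1
  refine lt_of_lt_of_le (ENNReal.ofReal_pos.2 (one_div_pos.2 hM1)) (h1 ▸ measure_mono ?_)
  rintro z ⟨h2, h3⟩
  exact ⟨hM z ((le_max_left _ _).trans h3), h2⟩

end PolygonalCusp

/-! ### The isoperimetric theorem -/

theorem lemma2p9 (p : ℕ) (hp : 1 ≤ p) (P : PolygonalCusp p) :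
    (∃ R : PolygonalCusp p, R.IsRegular ∧ R.area = P.area) ∧
      ∀ R : PolygonalCusp p, R.IsRegular → R.area = P.area →
        R.perimeter ≤ P.perimeter ∧ (R.perimeter = P.perimeter → P.IsRegular) := by
  have hp0 : (0 : ℝ) < p := by exact_mod_cast hp
  obtain ⟨hle, heq⟩ := P.area_le_maxAreaAbove hp
  have hperim : ∀ Q : PolygonalCusp p, 0 ≤ Q.perimeter / p := fun Q =>
    div_nonneg (Finset.sum_nonneg fun _ _ => dist_nonneg) hp0.le
  constructor
  · have hfin : P.area ≠ ⊤ := (hle.trans_lt ENNReal.ofReal_lt_top).ne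
    have hlt : P.area.toReal < p * Real.pi := by
      refine lt_of_le_of_lt (ENNReal.toReal_le_of_le_ofReal ?_ hle)
        (mul_lt_mul_of_pos_left (maxAreaAbove_lt_pi _) hp0)
      exact mul_nonneg hp0.le (maxAreaAbove_nonneg (hperim P))
    obtain ⟨R, hR, hA⟩ := PolygonalCusp.exists_isUniform_area_eq hp
      (ENNReal.toReal_pos P.area_pos.ne' hfin) hlt
    exact ⟨R, hR.isRegular, hA.trans (ENNReal.ofReal_toReal hfin)⟩
  · intro R hR hA
    have hRA := (hR.isUniform hp).area_eq hp
    constructor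
    · rw [← hA, hRA, ENNReal.ofReal_le_ofReal_iff
        (mul_nonneg hp0.le (maxAreaAbove_nonneg (hperim P)))] at hle
      have h1 := strictMono_maxAreaAbove.le_iff_le.1 (le_of_mul_le_mul_left hle hp0)
      exact (div_le_div_iff_of_pos_right hp0).1 h1
    · intro h
      rw [← hA, hRA, h] at heq
      obtain ⟨him, hlen⟩ := heq rfl
      exact (P.isUniform_of_im_eq hp him hlen).isRegular
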